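/- Let $n\ge 4$, $c\in\{1,0,-1\}$, let $R^{n-1}(c)$ be the Riemannian space form $\mathbb S^{n-1}$, $\mathbb E^{n-1}$ or $\mathbb H^{n-1}$ of curvature $c$ with metric $g_c$, let $I\subset\mathbb R$ be an open interval and $f:I\to\mathbb R$ a smooth non-vanishing function. Let $L^n_1(f,c)=I\times R^{n-1}(c)$ be the Robertson-Walker space with the Lorentzian metric $\langle\cdot,\cdot\rangle=-dt^2+f(t)^2g_c$, and assume that $\frac{f''(t)}{f(t)}-\frac{f'(t)^2+c}{f(t)^2}\ne 0$ for every $t\in I$. Let $\phi:M\to L^n_1(f,c)$ be a smooth space-like immersion of a connected surface, with $M$ carrying the induced metric, with second fundamental form $h$, normal connection $\nabla^\perp$ and mean curvature vector $H=\frac12\operatorname{tr}h$. Let $\frac{\partial}{\partial t}|_M=T+\eta$ be the decomposition of $\frac{\partial}{\partial t}$ along $\phi$ into its tangential part $T$ and normal part $\eta$, and assume that $T$ vanishes nowhere on $M$. Suppose that $M$ is PMCV, i.e. $\nabla^\perp H=0$, and biconservative, i.e. the tangential part of the bitension field $\tau_2(\phi)=\Delta\tau(\phi)-\operatorname{tr}\widetilde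 R(d\phi,\tau(\phi))d\phi$ vanishes, where $\tau(\phi)=\operatorname{tr}\nabla d\phi$, $\Delta U=\operatorname{tr}(\nabla_\cdot\nabla_\cdot U)$ is the rough Laplacian on sections of $\phi^{-1}TL^n_1(f,c)$, and $\widetilde R$ is the curvature tensor of $L^n_1(f,c)$, with the convention $\widetilde R(X,Y)Z=\widetilde\nabla_X\widetilde\nabla_YZ-\widetilde\nabla_Y\widetilde\nabla_XZ-\widetilde\nabla_{[X,Y]}Z$. Then $\langle H,\eta\rangle=0$ on $M$, and $H$ is space-like at every point of $M$ (that is, $\langle H,H\rangle>0$ or $H=0$). In particular $M$ is not marginally trapped, where marginally trapped means that $H$ is light-like ($\langle H,H\rangle=0$ and $H\neq0$) at every point: there are no marginally trapped biconservative PMCV surfaces in $L^n_1(f,c)$. -/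

import Mathlib

open Set
open scoped Manifold ContDiff Topology

noncomputable section

/-! ### Semi-Riemannian geometry of a map, in coordinates

`E` is the coordinate space of the target; a metric in coordinates is a field `G` of bilinear forms
on `E`.  A map from an `m`-dimensional manifold is read in coordinates as
`u : EuclideanSpace ℝ (Fin m) → E`. -/

namespace LocalGeom

variable {E : Type*} [NormedAddCommGroup E] [NormedSpace ℝ E]

/-- Christoffel symbols of the Levi-Civita connection of `G`: `christoffel G y v w` is the vector `Γ`
with `2 G(Γ, z) = (∂_v G)(w, z) + (∂_w G)(v, z) - (∂_z G)(v, w)` for all `z`. The map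
`(G y).inverse` is the musical isomorphism `E* → E`, the inverse of `v ↦ G y v`. -/
def christoffel (G : E → E →L[ℝ] E →L[ℝ] ℝ) (y v w : E) : E :=
  (G y).inverse ((1 / 2 : ℝ) •
    (fderiv ℝ G y v w + fderiv ℝ G y w v - ((fderiv ℝ G y).flip v).flip w))

/-- The curvature tensor `R(a, b)w = ∇_a ∇_b w - ∇_b ∇_a w - ∇_[a,b] w` of `G`. -/
def curvature (G : E → E →L[ℝ] E →L[ℝ] ℝ) (y a b w : E) : E :=
  fderiv ℝ (fun z => christoffel G z b w) y a - fderiv ℝ (fun z => christoffel G z a w) y b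
    + christoffel G y a (christoffel G y b w) - christoffel G y b (christoffel G y a w)

variable {m : ℕ}

local notation "𝔼" m => EuclideanSpace ℝ (Fin m)

/-- The induced metric (first fundamental form) `u^* G`. -/
def inducedMetric (G : E → E →L[ℝ] E →L[ℝ] ℝ) (u : (𝔼 m) → E) (x : 𝔼 m) :
    (𝔼 m) →L[ℝ] (𝔼 m) →L[ℝ] ℝ :=
  (G (u x)).bilinearComp (fderiv ℝ u x) (fderiv ℝ u x)

/-- The trace `∑ g^{ij} B(e_i, e_j)` of a bilinear map `B` with respect to a nondegenerate form `g`. -/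
def metricTrace (g : (𝔼 m) →L[ℝ] (𝔼 m) →L[ℝ] ℝ) (B : (𝔼 m) → (𝔼 m) → E) : E :=
  ∑ i : Fin m, B (EuclideanSpace.single i 1) (g.inverse (EuclideanSpace.proj i))

/-- The covariant derivative `∇_v V` at `x` of a vector field `V` along `u`: the pullback of the
Levi-Civita connection of `G`. -/
def covDerivAlong (G : E → E →L[ℝ] E →L[ℝ] ℝ) (u V : (𝔼 m) → E) (x v : 𝔼 m) : E :=
  fderiv ℝ V x v + christoffel G (u x) (fderiv ℝ u x v) (V x)

/-- The second fundamental form `h(v, w) = ∇_v (du w) - du (∇_v w)` (Gauss formula), where the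
second `∇` is the Levi-Civita connection of the induced metric. -/
def secondFundForm (G : E → E →L[ℝ] E →L[ℝ] ℝ) (u : (𝔼 m) → E) (x v w : 𝔼 m) : E :=
  covDerivAlong G u (fun z => fderiv ℝ u z w) x v
    - fderiv ℝ u x (christoffel (inducedMetric G u) x v w)

/-- The tension field `τ = tr ∇du` of the isometric immersion `u`. -/
def tension (G : E → E →L[ℝ] E →L[ℝ] ℝ) (u : (𝔼 m) → E) (x : 𝔼 m) : E :=
  metricTrace (inducedMetric G u x) (secondFundForm G u x)

/-- The mean curvature vector `H = (1/m) tr h`. -/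
def meanCurv (G : E → E →L[ℝ] E →L[ℝ] ℝ) (u : (𝔼 m) → E) (x : 𝔼 m) : E :=
  (1 / (m : ℝ)) • metricTrace (inducedMetric G u x) (secondFundForm G u x)

/-- The tangential part of a vector of the target, as a vector of the source: `W` is the tangential
part of `X` if `g(W, v) = G(X, du v)` for all `v`, where `g` is the induced metric. -/
def tangentPart (G : E → E →L[ℝ] E →L[ℝ] ℝ) (u : (𝔼 m) → E) (x : 𝔼 m) (X : E) : 𝔼 m :=
  (inducedMetric G u x).inverse ((G (u x) X).comp (fderiv ℝ u x))

/-- The normal part of a vector of the target. -/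
def normalPart (G : E → E →L[ℝ] E →L[ℝ] ℝ) (u : (𝔼 m) → E) (x : 𝔼 m) (X : E) : E :=
  X - fderiv ℝ u x (tangentPart G u x X)

/-- The normal connection `∇^⊥_v ξ = (∇_v ξ)^⊥`. -/
def normalCovDeriv (G : E → E →L[ℝ] E →L[ℝ] ℝ) (u ξ : (𝔼 m) → E) (x v : 𝔼 m) : E :=
  normalPart G u x (covDerivAlong G u ξ x v)

/-- The rough Laplacian `ΔV = tr (∇_· ∇_· V)`, i.e. the trace of
`(v, w) ↦ ∇_v ∇_w V - ∇_{∇_v w} V`. -/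
def roughLaplacian (G : E → E →L[ℝ] E →L[ℝ] ℝ) (u V : (𝔼 m) → E) (x : 𝔼 m) : E :=
  metricTrace (inducedMetric G u x) (fun v w =>
    covDerivAlong G u (fun z => covDerivAlong G u V z w) x v
      - covDerivAlong G u V x (christoffel (inducedMetric G u) x v w))

/-- The bitension field `τ₂ = Δτ - tr R(du, τ)du`. -/
def bitension (G : E → E →L[ℝ] E →L[ℝ] ℝ) (u : (𝔼 m) → E) (x : 𝔼 m) : E :=
  roughLaplacian G u (tension G u) x
    - metricTrace (inducedMetric G u x) (fun v w =>
        curvature G (u x) (fderiv ℝ u x v) (tension G u x) (fderiv ℝ u x w))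

end LocalGeom

/-! ### Maps from an `m`-dimensional manifold into a semi-Riemannian manifold -/

section Manifold

variable {m : ℕ} {M : Type*} [TopologicalSpace M] [ChartedSpace (EuclideanSpace ℝ (Fin m)) M]
  {E : Type*} [NormedAddCommGroup E] [NormedSpace ℝ E] {H : Type*} [TopologicalSpace H]
  (J : ModelWithCorners ℝ E H) {N : Type*} [TopologicalSpace N] [ChartedSpace H N]

/-- The representation in the chart `e'` of the metric `g` of `N`. -/
def metricInChart (g : ∀ p : N, TangentSpace J p →L[ℝ] TangentSpace J p →L[ℝ] ℝ)
    (e' : OpenPartialHomeomorph N H) (y : E) : E →L[ℝ] E →L[ℝ] ℝ :=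
  let B : E →L[ℝ] E →L[ℝ] ℝ := g ((e'.extend J).symm y)
  let A : E →L[ℝ] E := mfderiv 𝓘(ℝ, E) J (e'.extend J).symm y
  B.bilinearComp A A

/-- The representation in the chart `e'` of the vector field `X` on `N`. -/
def fieldInChart (X : ∀ p : N, TangentSpace J p) (e' : OpenPartialHomeomorph N H) (y : E) : E :=
  mfderiv J 𝓘(ℝ, E) (e'.extend J) ((e'.extend J).symm y) (X ((e'.extend J).symm y))

/-- The representation of the map `φ` in the charts `e` of `M` and `e'` of `N`. -/
def mapInChart (φ : M → N) (e : OpenPartialHomeomorph M (EuclideanSpace ℝ (Fin m)))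
    (e' : OpenPartialHomeomorph N H) (x : EuclideanSpace ℝ (Fin m)) : E :=
  e'.extend J (φ (e.symm x))

/-- The (open, if `φ` is continuous) set on which `mapInChart J φ e e'` represents `φ`. -/
def chartDomain (φ : M → N) (e : OpenPartialHomeomorph M (EuclideanSpace ℝ (Fin m)))
    (e' : OpenPartialHomeomorph N H) : Set (EuclideanSpace ℝ (Fin m)) :=
  {x | x ∈ e.target ∧ φ (e.symm x) ∈ e'.source}

variable (m) in
/-- The property `P` of (chart of `N`, metric of `N`, map `φ`, point of `M`), expressed in
coordinates, holds at all points of `M` in all charts of `M` and `N`. -/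
def HoldsInCharts (g : ∀ p : N, TangentSpace J p →L[ℝ] TangentSpace J p →L[ℝ] ℝ) (φ : M → N)
    (P : OpenPartialHomeomorph N H → (E → E →L[ℝ] E →L[ℝ] ℝ) →
      (EuclideanSpace ℝ (Fin m) → E) → EuclideanSpace ℝ (Fin m) → Prop) : Prop :=
  ∀ e ∈ atlas (EuclideanSpace ℝ (Fin m)) M, ∀ e' ∈ atlas H N, ∀ x ∈ chartDomain φ e e',
    P e' (metricInChart J g e') (mapInChart J φ e e') x

variable (m) in
/-- `φ` is space-like: the induced metric is positive definite
(in particular, a smooth space-like map is an immersion). -/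
def IsSpacelike (g : ∀ p : N, TangentSpace J p →L[ℝ] TangentSpace J p →L[ℝ] ℝ) (φ : M → N) : Prop :=
  ∀ (p : M) (v : TangentSpace 𝓘(ℝ, EuclideanSpace ℝ (Fin m)) p), v ≠ 0 →
    0 < g (φ p) (mfderiv 𝓘(ℝ, EuclideanSpace ℝ (Fin m)) J φ p v)
      (mfderiv 𝓘(ℝ, EuclideanSpace ℝ (Fin m)) J φ p v)

variable (m) in
/-- `φ` has parallel mean curvature vector: `∇^⊥ H = 0`. -/
def IsPMCV (g : ∀ p : N, TangentSpace J p →L[ℝ] TangentSpace J p →L[ℝ] ℝ) (φ : M → N) : Prop :=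
  HoldsInCharts m J g φ fun _ G u x =>
    ∀ v, LocalGeom.normalCovDeriv G u (LocalGeom.meanCurv G u) x v = 0

variable (m) in
/-- `φ`, an isometric immersion for the induced metric, is biconservative: `(τ₂)^T = 0`. -/
def IsBiconservative (g : ∀ p : N, TangentSpace J p →L[ℝ] TangentSpace J p →L[ℝ] ℝ)
    (φ : M → N) : Prop :=
  HoldsInCharts m J g φ fun _ G u x =>
    LocalGeom.tangentPart G u x (LocalGeom.bitension G u x) = 0

variable (m) in
/-- `φ` is marginally trapped: `H` is null (light-like) at every point, that is,
`⟨H, H⟩ = 0` and `H ≠ 0`. -/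
def IsMarginallyTrapped (g : ∀ p : N, TangentSpace J p →L[ℝ] TangentSpace J p →L[ℝ] ℝ)
    (φ : M → N) : Prop :=
  HoldsInCharts m J g φ fun _ G u x =>
    G (u x) (LocalGeom.meanCurv G u x) (LocalGeom.meanCurv G u x) = 0 ∧
      LocalGeom.meanCurv G u x ≠ 0

end Manifold

/-! ### The Riemannian space forms `𝕊^m`, `𝔼^m`, `ℍ^m` -/

/-- The space form `R^m(c)`, `c = 1, 0, -1`, as the hyperquadric `a² + c |y|² = 1` in `ℝ × ℝ^m`
(with `a > 0` if `c ≤ 0`): the unit sphere for `c = 1`, the affine hyperplane `a = 1` for `c = 0`,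
and the upper sheet of the two-sheeted hyperboloid for `c = -1`. Its metric is
the restriction of `c da² + |dy|²`. -/
@[ext]
structure SpaceForm (m : ℕ) (c : ℝ) where
  /-- The inclusion of the hyperquadric in `ℝ × ℝ^m`. -/
  incl : ℝ × EuclideanSpace ℝ (Fin m)
  eq_one : incl.1 ^ 2 + c * ‖incl.2‖ ^ 2 = 1
  pos : c ≤ 0 → 0 < incl.1

namespace SpaceForm

variable {m : ℕ} {c : ℝ}

/-- The subspace topology. -/
instance : TopologicalSpace (SpaceForm m c) := TopologicalSpace.induced incl inferInstance

theorem incl_isInducing : Topology.IsInducing (incl : SpaceForm m c → _) := ⟨rfl⟩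

theorem continuous_incl : Continuous (incl : SpaceForm m c → _) := incl_isInducing.continuous

/-- The chart domain in `ℝ^m`. -/
def stereoTarget (m : ℕ) (c ε : ℝ) : Set (EuclideanSpace ℝ (Fin m)) :=
  {w | 0 < 1 + c * ‖w‖ ^ 2 / 4 ∧ (c ≤ 0 → 0 < ε)}

/-- The inverse of stereographic projection from the point `(-ε, 0)`, as a map into `ℝ × ℝ^m`. -/
def stereoInv (c ε : ℝ) (w : EuclideanSpace ℝ (Fin m)) : ℝ × EuclideanSpace ℝ (Fin m) :=
  (ε * (1 - c * ‖w‖ ^ 2 / 4) / (1 + c * ‖w‖ ^ 2 / 4), (1 + c * ‖w‖ ^ 2 / 4)⁻¹ • w)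

theorem stereoInv_mem {ε : ℝ} (hε : ε ^ 2 = 1) {w : EuclideanSpace ℝ (Fin m)}
    (hw : w ∈ stereoTarget m c ε) :
    (stereoInv c ε w).1 ^ 2 + c * ‖(stereoInv c ε w).2‖ ^ 2 = 1 ∧
      (c ≤ 0 → 0 < (stereoInv c ε w).1) := by
  obtain ⟨h1, h2⟩ := hw
  constructor
  · have hne := h1.ne'
    simp only [stereoInv, norm_smul, norm_inv, Real.norm_eq_abs, abs_of_pos h1]
    rw [div_pow, mul_pow, mul_pow, hε, inv_pow, ← sub_eq_zero]
    generalize hs : c * ‖w‖ ^ 2 / 4 = s at *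
    have h4 : c * ‖w‖ ^ 2 = 4 * s := by rw [← hs]; ring
    have : c * (((1 + s) ^ 2)⁻¹ * ‖w‖ ^ 2) = 4 * s * ((1 + s) ^ 2)⁻¹ := by rw [← h4]; ring
    rw [this]
    field_simp
    ring
  · intro hc
    have h3 : c * ‖w‖ ^ 2 ≤ 0 := mul_nonpos_of_nonpos_of_nonneg hc (by positivity)
    exact div_pos (mul_pos (h2 hc) (by linarith)) h1

theorem contDiffOn_stereoInv (ε : ℝ) :
    ContDiffOn ℝ ∞ (stereoInv (m := m) c ε) (stereoTarget m c ε) := by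
  have hn : ContDiff ℝ ∞ fun w : EuclideanSpace ℝ (Fin m) => c * ‖w‖ ^ 2 / 4 :=
    (contDiff_const.mul (contDiff_norm_sq ℝ)).div_const _
  have hp : ContDiffOn ℝ ∞ (fun w : EuclideanSpace ℝ (Fin m) => 1 + c * ‖w‖ ^ 2 / 4)
      (stereoTarget m c ε) := (contDiff_const.add hn).contDiffOn
  have h0 : ∀ w ∈ stereoTarget m c ε, 1 + c * ‖w‖ ^ 2 / 4 ≠ 0 := fun w hw => ne_of_gt hw.1
  exact ContDiffOn.prodMk
    (ContDiffOn.div (contDiff_const.mul (contDiff_const.sub hn)).contDiffOn hp h0)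
    ((hp.inv h0).smul contDiffOn_id)

theorem stereo_identity {ε : ℝ} (hε : ε ^ 2 = 1) (q : SpaceForm m c) (hq : 0 < 1 + ε * q.incl.1) :
    1 + c * ‖(2 / (1 + ε * q.incl.1)) • q.incl.2‖ ^ 2 / 4 = 2 / (1 + ε * q.incl.1) := by
  have h : q.incl.1 ^ 2 + c * ‖q.incl.2‖ ^ 2 = 1 := q.eq_one
  have hne := hq.ne'
  rw [norm_smul, Real.norm_eq_abs, abs_of_pos (by positivity)]
  field_simp
  linear_combination 4 * h + 4 * q.incl.1 ^ 2 * hε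

theorem stereoInv_identity {ε : ℝ} (hε : ε ^ 2 = 1) {w : EuclideanSpace ℝ (Fin m)}
    (hw : 0 < 1 + c * ‖w‖ ^ 2 / 4) :
    1 + ε * (stereoInv c ε w).1 = 2 / (1 + c * ‖w‖ ^ 2 / 4) := by
  simp only [stereoInv]
  generalize c * ‖w‖ ^ 2 / 4 = s at *
  have hne := hw.ne'
  field_simp
  linear_combination (1 - s) * hε

open Classical in
/-- The inverse of stereographic projection from `(-ε, 0)` (with a junk value outside of the chart
domain). -/
def stereoInvPt {ε : ℝ} (hε : ε ^ 2 = 1) (w : EuclideanSpace ℝ (Fin m)) : SpaceForm m c :=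
  if hw : w ∈ stereoTarget m c ε then
    ⟨stereoInv c ε w, (stereoInv_mem hε hw).1, (stereoInv_mem hε hw).2⟩
  else ⟨(1, 0), by simp, by simp⟩

theorem incl_stereoInvPt {ε : ℝ} (hε : ε ^ 2 = 1) {w : EuclideanSpace ℝ (Fin m)}
    (hw : w ∈ stereoTarget m c ε) :
    (stereoInvPt hε w : SpaceForm m c).incl = stereoInv c ε w := by
  simp [stereoInvPt, hw]

theorem stereo_mem {ε : ℝ} (hε : ε ^ 2 = 1) (q : SpaceForm m c) (hq : 0 < 1 + ε * q.incl.1) :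
    (2 / (1 + ε * q.incl.1)) • q.incl.2 ∈ stereoTarget m c ε := by
  refine ⟨by rw [stereo_identity hε q hq]; positivity, ?_⟩
  intro hc
  have h := q.eq_one
  have ha := q.pos hc
  have h3 : c * ‖q.incl.2‖ ^ 2 ≤ 0 := mul_nonpos_of_nonpos_of_nonneg hc (by positivity)
  rcases sq_eq_one_iff.mp hε with rfl | rfl
  · norm_num
  · nlinarith

/-- Stereographic projection from `(-ε, 0)`, `ε = ±1`: the chart
`(a, y) ↦ 2 y / (1 + ε a)` of the hyperquadric. -/
def stereo (m : ℕ) (c ε : ℝ) (hε : ε ^ 2 = 1) :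
    OpenPartialHomeomorph (SpaceForm m c) (EuclideanSpace ℝ (Fin m)) where
  toFun q := (2 / (1 + ε * q.incl.1)) • q.incl.2
  invFun w := stereoInvPt hε w
  source := {q | 0 < 1 + ε * q.incl.1}
  target := stereoTarget m c ε
  map_source' q hq := stereo_mem hε q hq
  map_target' w hw := by
    change 0 < 1 + ε * (stereoInvPt hε w : SpaceForm m c).incl.1
    rw [incl_stereoInvPt hε hw, stereoInv_identity hε hw.1]
    exact div_pos two_pos hw.1
  left_inv' q hq := by
    have hq' : 0 < 1 + ε * q.incl.1 := hq
    have h := stereo_identity hε q hq'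
    have hne := hq'.ne'
    have h5 : 1 - c * ‖(2 / (1 + ε * q.incl.1)) • q.incl.2‖ ^ 2 / 4
        = 2 - 2 / (1 + ε * q.incl.1) := by linarith
    apply SpaceForm.ext
    rw [incl_stereoInvPt hε (stereo_mem hε q hq')]
    refine Prod.ext ?_ ?_
    · simp only [stereoInv]
      rw [h, h5]
      field_simp
      linear_combination q.incl.1 * hε
    · simp only [stereoInv]
      rw [h, smul_smul, inv_mul_cancel₀ (by positivity), one_smul]
  right_inv' w hw := by
    have h1 : 0 < 1 + c * ‖w‖ ^ 2 / 4 := hw.1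
    rw [incl_stereoInvPt hε hw, stereoInv_identity hε h1]
    simp only [stereoInv, smul_smul]
    have : 2 / (2 / (1 + c * ‖w‖ ^ 2 / 4)) * (1 + c * ‖w‖ ^ 2 / 4)⁻¹ = 1 := by
      have hne := h1.ne'
      generalize 1 + c * ‖w‖ ^ 2 / 4 = s at *
      field_simp
    rw [this, one_smul]
  open_source := isOpen_lt continuous_const
    (continuous_const.add (continuous_const.mul continuous_incl.fst))
  open_target := by
    have h : IsOpen {w : EuclideanSpace ℝ (Fin m) | 0 < 1 + c * ‖w‖ ^ 2 / 4} :=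
      isOpen_lt continuous_const (by fun_prop)
    exact h.inter isOpen_const
  continuousOn_toFun := by
    have h := continuous_incl (m := m) (c := c)
    have h1 : ContinuousOn (fun q : SpaceForm m c => 2 / (1 + ε * q.incl.1))
        {q | 0 < 1 + ε * q.incl.1} :=
      ContinuousOn.div (by fun_prop) (by fun_prop) fun q hq => ne_of_gt hq
    exact h1.smul (by fun_prop)
  continuousOn_invFun := by
    rw [incl_isInducing.continuousOn_iff]
    exact (contDiffOn_stereoInv ε).continuousOn.congr fun w hw => incl_stereoInvPt hε hw

open Classical in
/-- The smooth structure of the space form, given by the two stereographic projections. -/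
instance : ChartedSpace (EuclideanSpace ℝ (Fin m)) (SpaceForm m c) where
  atlas := {e | ∃ (ε : ℝ) (hε : ε ^ 2 = 1), e = stereo m c ε hε}
  chartAt q := if 0 < q.incl.1 then stereo m c 1 (by norm_num) else stereo m c (-1) (by norm_num)
  mem_chart_source q := by
    split_ifs with h
    · change 0 < 1 + 1 * q.incl.1
      linarith
    · change 0 < 1 + -1 * q.incl.1
      linarith
  chart_mem_atlas q := by
    split_ifs
    · exact ⟨1, by norm_num, rfl⟩
    · exact ⟨-1, by norm_num, rfl⟩

instance : IsManifold 𝓘(ℝ, EuclideanSpace ℝ (Fin m)) ∞ (SpaceForm m c) := by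
  refine isManifold_of_contDiffOn _ _ _ ?_
  rintro _ _ ⟨ε, hε, rfl⟩ ⟨δ, hδ, rfl⟩
  have h1 := contDiffOn_stereoInv (m := m) (c := c) ε
  simp only [modelWithCornersSelf_coe, modelWithCornersSelf_coe_symm, Function.comp_id,
    Function.id_comp, preimage_id, range_id, inter_univ]
  have hT : ∀ w ∈ ((stereo m c ε hε).symm.trans (stereo m c δ hδ)).source,
      w ∈ stereoTarget m c ε ∧ 0 < 1 + δ * (stereoInv c ε w).1 := by
    intro w hw
    rw [OpenPartialHomeomorph.trans_source] at hw
    refine ⟨hw.1, ?_⟩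
    have h2 : 0 < 1 + δ * ((stereo m c ε hε).symm w).incl.1 := hw.2
    have h3 := incl_stereoInvPt (c := c) hε hw.1
    change 0 < 1 + δ * (stereoInvPt hε w : SpaceForm m c).incl.1 at h2
    rwa [h3] at h2
  have h2 := h1.mono fun w hw => (hT w hw).1
  have h3 : ContDiffOn ℝ ∞ (fun w => (2 / (1 + δ * (stereoInv c ε w).1)) • (stereoInv c ε w).2)
      ((stereo m c ε hε).symm.trans (stereo m c δ hδ)).source :=
    ContDiffOn.smul (ContDiffOn.div (by fun_prop)
      (contDiffOn_const.add (contDiffOn_const.mul h2.fst)) fun w hw => ne_of_gt (hT w hw).2) h2.snd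
  refine h3.congr fun w hw => ?_
  change (2 / (1 + δ * (stereoInvPt hε w : SpaceForm m c).incl.1)) •
    (stereoInvPt hε w : SpaceForm m c).incl.2 = _
  rw [incl_stereoInvPt hε (hT w hw).1]

end SpaceForm

/-! ### Robertson-Walker spaces -/

/-- The manifold `I × R^m(c)` underlying the Robertson-Walker space `L^{m+1}_1(f, c)`. -/
abbrev RobertsonWalker (I : TopologicalSpace.Opens ℝ) (m : ℕ) (c : ℝ) : Type := I × SpaceForm m c

namespace RobertsonWalker

variable (I : TopologicalSpace.Opens ℝ) (m : ℕ) (c : ℝ)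

/-- The model with corners of `I × R^m(c)` (without boundary). -/
abbrev model (m : ℕ) : ModelWithCorners ℝ (ℝ × EuclideanSpace ℝ (Fin m))
    (ModelProd ℝ (EuclideanSpace ℝ (Fin m))) :=
  𝓘(ℝ, ℝ).prod 𝓘(ℝ, EuclideanSpace ℝ (Fin m))

variable {I m c}

/-- The differential of the coordinate function `t`. -/
def dt (p : RobertsonWalker I m c) : TangentSpace (model m) p →L[ℝ] ℝ :=
  mfderiv (model m) 𝓘(ℝ, ℝ) (fun q : RobertsonWalker I m c => (q.1 : ℝ)) p

/-- The differential of `(t, q) ↦ q`, with values in the ambient space `ℝ × ℝ^m` of `R^m(c)`. -/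
def dx (p : RobertsonWalker I m c) :
    TangentSpace (model m) p →L[ℝ] ℝ × EuclideanSpace ℝ (Fin m) :=
  mfderiv (model m) 𝓘(ℝ, ℝ × EuclideanSpace ℝ (Fin m))
    (fun q : RobertsonWalker I m c => q.2.incl) p

/-- The form `c da² + |dy|²` on `ℝ × ℝ^m`, which restricts to the metric `g_c` of `R^m(c)`. -/
def ambientForm (m : ℕ) (c : ℝ) : (ℝ × EuclideanSpace ℝ (Fin m)) →L[ℝ]
    (ℝ × EuclideanSpace ℝ (Fin m)) →L[ℝ] ℝ :=
  c • (ContinuousLinearMap.mul ℝ ℝ).bilinearComp (ContinuousLinearMap.fst ℝ _ _)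
      (ContinuousLinearMap.fst ℝ _ _)
    + (innerSL ℝ).bilinearComp (ContinuousLinearMap.snd ℝ _ _) (ContinuousLinearMap.snd ℝ _ _)

/-- The metric `-dt² + f(t)² g_c` of the Robertson-Walker space. -/
def metric (f : ℝ → ℝ) (p : RobertsonWalker I m c) :
    TangentSpace (model m) p →L[ℝ] TangentSpace (model m) p →L[ℝ] ℝ :=
  let τ : ℝ × EuclideanSpace ℝ (Fin m) →L[ℝ] ℝ := dt p
  let ξ : ℝ × EuclideanSpace ℝ (Fin m) →L[ℝ] ℝ × EuclideanSpace ℝ (Fin m) := dx p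
  f p.1 ^ 2 • (ambientForm m c).bilinearComp ξ ξ - (ContinuousLinearMap.mul ℝ ℝ).bilinearComp τ τ

/-- The comoving observer field `∂/∂t` (the chart of the open set `I` of `ℝ` is the inclusion, so the
tangent space of `I × R^m(c)` is `ℝ × ℝ^m` with first component the `∂/∂t`-component). -/
def comoving (p : RobertsonWalker I m c) : TangentSpace (model m) p :=
  ((1, 0) : ℝ × EuclideanSpace ℝ (Fin m))

variable {k : ℕ} {M : Type*} [TopologicalSpace M]
  [ChartedSpace (EuclideanSpace ℝ (Fin k)) M]

variable (k) in
/-- In the decomposition `∂/∂t = T + η` along `φ` into tangential and normal parts,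
`T` vanishes nowhere. -/
def TNonvanishing (f : ℝ → ℝ) (φ : M → RobertsonWalker I m c) : Prop :=
  HoldsInCharts k (model m) (metric f) φ fun e' G u x =>
    LocalGeom.tangentPart G u x (fieldInChart (model m) comoving e' (u x)) ≠ 0

variable (k) in
/-- In the decomposition `∂/∂t = T + η` along `φ` into tangential and normal parts,
`⟨H, η⟩ = 0` at every point. -/
def MeanCurvOrthogonalEta (f : ℝ → ℝ) (φ : M → RobertsonWalker I m c) : Prop :=
  HoldsInCharts k (model m) (metric f) φ fun e' G u x =>
    G (u x) (LocalGeom.meanCurv G u x)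
      (LocalGeom.normalPart G u x (fieldInChart (model m) comoving e' (u x))) = 0

variable (k) in
/-- The mean curvature vector of `φ` is space-like at every point: `⟨H, H⟩ > 0` or `H = 0`
(the zero vector counts as space-like). -/
def MeanCurvSpacelike (f : ℝ → ℝ) (φ : M → RobertsonWalker I m c) : Prop :=
  HoldsInCharts k (model m) (metric f) φ fun _ G u x =>
    0 < G (u x) (LocalGeom.meanCurv G u x) (LocalGeom.meanCurv G u x) ∨
      LocalGeom.meanCurv G u x = 0

end RobertsonWalker

end

/-!
The argument is local and takes place in charts. For an immersion whose mean curvature vector is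
parallel in the normal bundle, `∇τ` is tangential, and three facts about the second covariant
derivative of the tension field `τ` determine the tangential part of its rough Laplacian: the form
`⟨(∇²τ)(v, w), du k⟩` is symmetric in `w, k` (`metric_secondCovDeriv_symm`), exchanging `v, w` costs
a curvature term (`secondCovDeriv_sub`), and its trace over `w, k` is minus the derivative of the
constant `⟨τ, τ⟩` (`sum_metric_secondCovDeriv_tension`). Hence the tangential part of the bitension
field is a trace of the ambient curvature (`LocalGeom.IsImmersionOn.metric_bitension`). The
Codazzi equation is not needed separately: it is contained in the first two facts.

In a Robertson-Walker space the curvature tensor is explicit: apart from a part of constant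
curvature type, which does not contribute, it is `f''/f - (f'² + c)/f²` times a term built from `∂/∂t`
(`metric_curvature`). The tangential part of the bitension field is therefore a nonzero multiple of
`⟨τ, ∂/∂t⟩ T`, and where `T ≠ 0` biconservativity forces `⟨H, ∂/∂t⟩ = 0` (`meanCurv_fst_eq_zero`).
As `H` is normal, this is `⟨H, η⟩ = 0`; as `∂/∂t` is time-like, a vector orthogonal to it is
space-like or zero.
-/

noncomputable section

set_option maxSynthPendingDepth 3

/-! ### Semi-Riemannian metrics in coordinates -/

namespace LocalGeom

variable {E : Type*} [NormedAddCommGroup E] [NormedSpace ℝ E]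

/-- `G` is a smooth field of nondegenerate symmetric bilinear forms on the open set `U`, that is, a
semi-Riemannian metric on `U`. -/
structure IsMetricOn (G : E → E →L[ℝ] E →L[ℝ] ℝ) (U : Set E) : Prop where
  isOpen : IsOpen U
  contDiffOn : ContDiffOn ℝ ∞ G U
  symm : ∀ y ∈ U, ∀ v w, G y v w = G y w v
  invertible : ∀ y ∈ U, (G y).IsInvertible

theorem isInvertible_of_injective [FiniteDimensional ℝ E] (B : E →L[ℝ] E →L[ℝ] ℝ)
    (hB : Function.Injective B) : B.IsInvertible := by
  have hfin : Module.finrank ℝ E = Module.finrank ℝ (E →L[ℝ] ℝ) := by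
    rw [← (LinearMap.toContinuousLinearMap (𝕜 := ℝ) (E := E) (F' := ℝ)).finrank_eq,
      Module.finrank_linearMap, Module.finrank_self, mul_one]
  exact ⟨(LinearEquiv.ofInjectiveOfFinrankEq (B : E →ₗ[ℝ] E →L[ℝ] ℝ) hB
    hfin).toContinuousLinearEquiv, ContinuousLinearMap.ext fun _ => rfl⟩

/-- The Christoffel symbols of `G` as a continuous bilinear map. -/
def christoffelL (G : E → E →L[ℝ] E →L[ℝ] ℝ) (y : E) : E →L[ℝ] E →L[ℝ] E :=
  (ContinuousLinearMap.compL ℝ E (E →L[ℝ] ℝ) E (G y).inverse).comp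
    ((1 / 2 : ℝ) • (fderiv ℝ G y + (fderiv ℝ G y).flip
      - ((ContinuousLinearMap.flipₗᵢ ℝ E E ℝ).toContinuousLinearEquiv :
          (E →L[ℝ] E →L[ℝ] ℝ) →L[ℝ] (E →L[ℝ] E →L[ℝ] ℝ)).comp (fderiv ℝ G y).flip))

theorem christoffelL_apply (G : E → E →L[ℝ] E →L[ℝ] ℝ) (y v w : E) :
    christoffelL G y v w = christoffel G y v w := rfl

theorem contDiffOn_inverse {F' : Type*} [NormedAddCommGroup F'] [NormedSpace ℝ F']
    [CompleteSpace E] {X : Type*} [NormedAddCommGroup X] [NormedSpace ℝ X]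
    {A : X → E →L[ℝ] F'} {s : Set X} (hA : ContDiffOn ℝ ∞ A s)
    (hinv : ∀ x ∈ s, (A x).IsInvertible) : ContDiffOn ℝ ∞ (fun x => (A x).inverse) s :=
  fun x hx => (hinv x hx).contDiffAt_map_inverse.comp_contDiffWithinAt x (hA x hx)

namespace IsMetricOn

variable {G : E → E →L[ℝ] E →L[ℝ] ℝ} {U : Set E}

theorem contDiffOn_christoffelL [CompleteSpace E] (hG : IsMetricOn G U) :
    ContDiffOn ℝ ∞ (christoffelL G) U := by
  have hD : ContDiffOn ℝ ∞ (fderiv ℝ G) U :=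
    hG.contDiffOn.fderiv_of_isOpen hG.isOpen (by simp)
  have hF : ContDiffOn ℝ ∞ (fun y => (fderiv ℝ G y).flip) U :=
    (ContinuousLinearMap.flipₗᵢ ℝ E E
      (E →L[ℝ] ℝ)).toContinuousLinearEquiv.contDiff.comp_contDiffOn hD
  refine ContDiffOn.clm_comp ?_ (((hD.add hF).sub (contDiffOn_const.clm_comp hF)).const_smul _)
  exact (ContinuousLinearMap.contDiff _).comp_contDiffOn
    (contDiffOn_inverse hG.contDiffOn hG.invertible)

theorem differentiableAt (hG : IsMetricOn G U) {y : E} (hy : y ∈ U) : DifferentiableAt ℝ G y :=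
  (hG.contDiffOn.contDiffAt (hG.isOpen.mem_nhds hy)).differentiableAt (by simp)

/-- The derivative of a symmetric form is symmetric. -/
theorem fderiv_symm (hG : IsMetricOn G U) {y : E} (hy : y ∈ U) (z v w : E) :
    fderiv ℝ G y z v w = fderiv ℝ G y z w v := by
  have h1 : ∀ a b, fderiv ℝ (fun x => G x a b) y z = fderiv ℝ G y z a b := fun a b => by
    have h := ((hG.differentiableAt hy).hasFDerivAt.clm_apply (hasFDerivAt_const a y)).clm_apply
      (hasFDerivAt_const b y)
    rw [h.fderiv]; simp
  rw [← h1, ← h1]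
  congr 1
  refine Filter.EventuallyEq.fderiv_eq ?_
  filter_upwards [hG.isOpen.mem_nhds hy] with x hx using hG.symm x hx v w

theorem christoffel_symm (hG : IsMetricOn G U) {y : E} (hy : y ∈ U) (v w : E) :
    christoffel G y v w = christoffel G y w v := by
  unfold christoffel
  congr 2
  ext z
  simp only [sub_apply, add_apply,
    ContinuousLinearMap.flip_apply]
  rw [hG.fderiv_symm hy z v w]
  ring

/-- The Koszul formula. -/
theorem koszul (hG : IsMetricOn G U) {y : E} (hy : y ∈ U) (v w z : E) :
    G y (christoffel G y v w) z
      = (fderiv ℝ G y v w z + fderiv ℝ G y w v z - fderiv ℝ G y z v w) / 2 := by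
  unfold christoffel
  rw [(hG.invertible y hy).self_apply_inverse]
  simp only [smul_apply, sub_apply,
    add_apply, ContinuousLinearMap.flip_apply, smul_eq_mul]
  ring

/-- The Levi-Civita connection is metric. -/
theorem fderiv_apply (hG : IsMetricOn G U) {y : E} (hy : y ∈ U) (v w z : E) :
    fderiv ℝ G y v w z = G y (christoffel G y v w) z + G y w (christoffel G y v z) := by
  rw [hG.symm y hy w, hG.koszul hy, hG.koszul hy, hG.fderiv_symm hy v z w, hG.fderiv_symm hy w v z]
  ring

theorem eq_of_forall_apply (hG : IsMetricOn G U) {y : E} (hy : y ∈ U) {v w : E}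
    (h : ∀ z, G y v z = G y w z) : v = w :=
  (hG.invertible y hy).injective (ContinuousLinearMap.ext h)

end IsMetricOn

section Christoffel

variable (G : E → E →L[ℝ] E →L[ℝ] ℝ) (y v w w' : E) (a : ℝ)

theorem christoffel_add_right :
    christoffel G y v (w + w') = christoffel G y v w + christoffel G y v w' := by
  simp [← christoffelL_apply]

theorem christoffel_smul_right : christoffel G y v (a • w) = a • christoffel G y v w := by
  simp [← christoffelL_apply]

end Christoffel

/-! ### Immersions and the Gauss formula -/

variable {m : ℕ}

local notation "𝔼" m => EuclideanSpace ℝ (Fin m)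

/-- `u` is a smooth map from the open set `Ω` to the semi-Riemannian domain `(U, G)`, and the form
it induces is nondegenerate on `Ω`. -/
structure IsImmersionOn (G : E → E →L[ℝ] E →L[ℝ] ℝ) (U : Set E) (u : (𝔼 m) → E) (Ω : Set (𝔼 m)) :
    Prop where
  isMetricOn : IsMetricOn G U
  isOpen : IsOpen Ω
  contDiffOn : ContDiffOn ℝ ∞ u Ω
  mapsTo : MapsTo u Ω U
  invertible : ∀ x ∈ Ω, (inducedMetric G u x).IsInvertible

theorem inducedMetric_apply (G : E → E →L[ℝ] E →L[ℝ] ℝ) (u : (𝔼 m) → E) (x v w : 𝔼 m) :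
    inducedMetric G u x v w = G (u x) (fderiv ℝ u x v) (fderiv ℝ u x w) := rfl

/-- `∇_v V` is linear in `v`. -/
theorem covDerivAlong_sum_smul (G : E → E →L[ℝ] E →L[ℝ] ℝ) (u V : (𝔼 m) → E) (x : 𝔼 m) {ι : Type*}
    (s : Finset ι) (a : ι → ℝ) (v : ι → 𝔼 m) :
    covDerivAlong G u V x (∑ i ∈ s, a i • v i) = ∑ i ∈ s, a i • covDerivAlong G u V x (v i) := by
  simp [covDerivAlong, ← christoffelL_apply, Finset.sum_add_distrib]

theorem covDerivAlong_const_smul (G : E → E →L[ℝ] E →L[ℝ] ℝ) (u : (𝔼 m) → E) {V : (𝔼 m) → E}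
    {x : 𝔼 m} (hV : DifferentiableAt ℝ V x) (a : ℝ) (v : 𝔼 m) :
    covDerivAlong G u (fun z => a • V z) x v = a • covDerivAlong G u V x v := by
  rw [covDerivAlong, covDerivAlong, christoffel_smul_right, smul_add, fderiv_fun_const_smul hV]
  rfl

namespace IsImmersionOn

variable {G : E → E →L[ℝ] E →L[ℝ] ℝ} {U : Set E} {u : (𝔼 m) → E} {Ω : Set (𝔼 m)}

theorem contDiffOn_fderiv (hu : IsImmersionOn G U u Ω) : ContDiffOn ℝ ∞ (fderiv ℝ u) Ω :=
  hu.contDiffOn.fderiv_of_isOpen hu.isOpen (by simp)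

theorem contDiffOn_fderiv_apply (hu : IsImmersionOn G U u Ω) (w : 𝔼 m) :
    ContDiffOn ℝ ∞ (fun x => fderiv ℝ u x w) Ω := hu.contDiffOn_fderiv.clm_apply contDiffOn_const

theorem contDiffOn_metric (hu : IsImmersionOn G U u Ω) : ContDiffOn ℝ ∞ (fun x => G (u x)) Ω :=
  hu.isMetricOn.contDiffOn.comp hu.contDiffOn hu.mapsTo

theorem contDiffOn_inducedMetric (hu : IsImmersionOn G U u Ω) :
    ContDiffOn ℝ ∞ (inducedMetric G u) Ω := by
  have hD := hu.contDiffOn_fderiv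
  have h1 : ContDiffOn ℝ ∞ (fun x => (G (u x)).comp (fderiv ℝ u x)) Ω :=
    hu.contDiffOn_metric.clm_comp hD
  have h2 := (ContinuousLinearMap.flipₗᵢ ℝ (𝔼 m) E
    ℝ).toContinuousLinearEquiv.contDiff.comp_contDiffOn h1
  exact (ContinuousLinearMap.flipₗᵢ ℝ (𝔼 m) (𝔼 m)
    ℝ).toContinuousLinearEquiv.contDiff.comp_contDiffOn (h2.clm_comp hD)

theorem isMetricOn_inducedMetric (hu : IsImmersionOn G U u Ω) :
    IsMetricOn (inducedMetric G u) Ω where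
  isOpen := hu.isOpen
  contDiffOn := hu.contDiffOn_inducedMetric
  symm x hx _ _ := hu.isMetricOn.symm (u x) (hu.mapsTo hx) _ _
  invertible := hu.invertible

theorem differentiableAt_of_contDiffOn (hu : IsImmersionOn G U u Ω) {F : Type*}
    [NormedAddCommGroup F] [NormedSpace ℝ F] {V : (𝔼 m) → F} (hV : ContDiffOn ℝ ∞ V Ω) {x : 𝔼 m}
    (hx : x ∈ Ω) : DifferentiableAt ℝ V x :=
  (hV.contDiffAt (hu.isOpen.mem_nhds hx)).differentiableAt (by simp)

theorem contDiffOn_christoffelL_comp [CompleteSpace E] (hu : IsImmersionOn G U u Ω) :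
    ContDiffOn ℝ ∞ (fun x => christoffelL G (u x)) Ω :=
  hu.isMetricOn.contDiffOn_christoffelL.comp hu.contDiffOn hu.mapsTo

theorem contDiffOn_covDerivAlong [CompleteSpace E] (hu : IsImmersionOn G U u Ω) {V : (𝔼 m) → E}
    (hV : ContDiffOn ℝ ∞ V Ω) (w : 𝔼 m) : ContDiffOn ℝ ∞ (fun x => covDerivAlong G u V x w) Ω :=
  ((hV.fderiv_of_isOpen hu.isOpen (by simp)).clm_apply contDiffOn_const).add
    ((hu.contDiffOn_christoffelL_comp.clm_apply (hu.contDiffOn_fderiv_apply w)).clm_apply hV)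

/-- The covariant derivative along `u` is metric. -/
theorem fderiv_metric (hu : IsImmersionOn G U u Ω) {V W : (𝔼 m) → E} {x : 𝔼 m} (hx : x ∈ Ω)
    (hV : DifferentiableAt ℝ V x) (hW : DifferentiableAt ℝ W x) (v : 𝔼 m) :
    fderiv ℝ (fun z => G (u z) (V z) (W z)) x v
      = G (u x) (covDerivAlong G u V x v) (W x) + G (u x) (V x) (covDerivAlong G u W x v) := by
  have hux := hu.differentiableAt_of_contDiffOn hu.contDiffOn hx
  have hG := (hu.isMetricOn.differentiableAt (hu.mapsTo hx)).hasFDerivAt.comp x hux.hasFDerivAt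
  have h := (HasFDerivAt.clm_apply (HasFDerivAt.clm_apply hG hV.hasFDerivAt) hW.hasFDerivAt).fderiv
  change fderiv ℝ (fun z => G (u z) (V z) (W z)) x = _ at h
  rw [h]
  simp only [covDerivAlong, map_add, add_apply, ContinuousLinearMap.comp_apply,
    ContinuousLinearMap.flip_apply, Function.comp_apply,
    hu.isMetricOn.fderiv_apply (hu.mapsTo hx)]
  ring

theorem fderiv_fderiv_symm (hu : IsImmersionOn G U u Ω) {x : 𝔼 m} (hx : x ∈ Ω) (v w : 𝔼 m) :
    fderiv ℝ (fun z => fderiv ℝ u z w) x v = fderiv ℝ (fun z => fderiv ℝ u z v) x w := by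
  have hD := (hu.differentiableAt_of_contDiffOn hu.contDiffOn_fderiv hx).hasFDerivAt
  have hS : IsSymmSndFDerivAt ℝ u x :=
    (hu.contDiffOn.contDiffAt (hu.isOpen.mem_nhds hx)).isSymmSndFDerivAt
      (by simpa using ENat.LEInfty.out)
  rw [(hD.clm_apply (hasFDerivAt_const w x)).fderiv, (hD.clm_apply (hasFDerivAt_const v x)).fderiv]
  simpa using hS v w

/-- The pullback of the Levi-Civita connection is torsion-free. -/
theorem covDerivAlong_fderiv_symm (hu : IsImmersionOn G U u Ω) {x : 𝔼 m} (hx : x ∈ Ω)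
    (v w : 𝔼 m) : covDerivAlong G u (fun z => fderiv ℝ u z w) x v
      = covDerivAlong G u (fun z => fderiv ℝ u z v) x w := by
  rw [covDerivAlong, covDerivAlong, hu.fderiv_fderiv_symm hx,
    hu.isMetricOn.christoffel_symm (hu.mapsTo hx)]

/-- The curvature of the pullback connection is the pullback of the curvature. -/
theorem covDerivAlong_comm [CompleteSpace E] (hu : IsImmersionOn G U u Ω)
    {V : (𝔼 m) → E} (hV : ContDiffOn ℝ ∞ V Ω) {x : 𝔼 m} (hx : x ∈ Ω) (v w : 𝔼 m) :
    covDerivAlong G u (fun z => covDerivAlong G u V z w) x v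
      - covDerivAlong G u (fun z => covDerivAlong G u V z v) x w
      = curvature G (u x) (fderiv ℝ u x v) (fderiv ℝ u x w) (V x) := by
  have hux := hu.differentiableAt_of_contDiffOn hu.contDiffOn hx
  have hVx := hu.differentiableAt_of_contDiffOn hV hx
  have hC := ((hu.isMetricOn.contDiffOn_christoffelL.contDiffAt
    (hu.isMetricOn.isOpen.mem_nhds (hu.mapsTo hx))).differentiableAt (by simp)).hasFDerivAt
  have hDV := (hu.differentiableAt_of_contDiffOn
    (hV.fderiv_of_isOpen hu.isOpen (m := ∞) (by simp)) hx).hasFDerivAt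
  have hS : IsSymmSndFDerivAt ℝ V x :=
    (hV.contDiffAt (hu.isOpen.mem_nhds hx)).isSymmSndFDerivAt
      (by simpa using ENat.LEInfty.out)
  have hDu : ∀ w, DifferentiableAt ℝ (fun z => fderiv ℝ u z w) x := fun w =>
    hu.differentiableAt_of_contDiffOn (hu.contDiffOn_fderiv_apply w) hx
  have key : ∀ v w, fderiv ℝ (fun z => covDerivAlong G u V z w) x v
      = fderiv ℝ (fderiv ℝ V) x v w
        + (fderiv ℝ (christoffelL G) (u x) (fderiv ℝ u x v) (fderiv ℝ u x w) (V x)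
        + christoffel G (u x) (fderiv ℝ (fun z => fderiv ℝ u z w) x v) (V x)
        + christoffel G (u x) (fderiv ℝ u x w) (fderiv ℝ V x v)) := fun v w => by
    have h1 := (HasFDerivAt.clm_apply (hC.comp x hux.hasFDerivAt) (hDu w).hasFDerivAt).clm_apply
      hVx.hasFDerivAt
    have h2 := ((hDV.clm_apply (hasFDerivAt_const w x)).add h1).fderiv
    change fderiv ℝ (fun z => covDerivAlong G u V z w) x = _ at h2
    rw [h2]
    simp [← christoffelL_apply]
    abel
  have key2 : ∀ a b w, fderiv ℝ (fun z => christoffel G z b w) (u x) a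
      = fderiv ℝ (christoffelL G) (u x) a b w := fun a b w => by
    have h := ((hC.clm_apply (hasFDerivAt_const b (u x))).clm_apply
      (hasFDerivAt_const w (u x))).fderiv
    change fderiv ℝ (fun z => christoffel G z b w) (u x) = _ at h
    rw [h]; simp
  have hc : ∀ W v, covDerivAlong G u W x v
      = fderiv ℝ W x v + christoffel G (u x) (fderiv ℝ u x v) (W x) := fun _ _ => rfl
  rw [hc (fun z => covDerivAlong G u V z w), hc (fun z => covDerivAlong G u V z v), key, key,
    curvature, key2, key2, hS.eq v w,
    hu.fderiv_fderiv_symm hx w v]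
  simp only [covDerivAlong, christoffel_add_right]
  abel

/-- The tangential part of `∇_v (du w)` is `du (∇_v w)`, for the Levi-Civita connection of the
induced metric. -/
theorem metric_covDerivAlong_fderiv (hu : IsImmersionOn G U u Ω) {x : 𝔼 m} (hx : x ∈ Ω)
    (v w z : 𝔼 m) : G (u x) (covDerivAlong G u (fun z => fderiv ℝ u z w) x v) (fderiv ℝ u x z)
      = G (u x) (fderiv ℝ u x (christoffel (inducedMetric G u) x v w)) (fderiv ℝ u x z) := by
  have hg := hu.isMetricOn_inducedMetric
  have hDu : ∀ w, DifferentiableAt ℝ (fun z => fderiv ℝ u z w) x := fun w =>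
    hu.differentiableAt_of_contDiffOn (hu.contDiffOn_fderiv_apply w) hx
  have key : ∀ a b c, fderiv ℝ (inducedMetric G u) x a b c
      = G (u x) (covDerivAlong G u (fun z => fderiv ℝ u z b) x a) (fderiv ℝ u x c)
        + G (u x) (covDerivAlong G u (fun z => fderiv ℝ u z c) x a) (fderiv ℝ u x b) := by
    intro a b c
    rw [hu.isMetricOn.symm _ (hu.mapsTo hx) (covDerivAlong G u (fun z => fderiv ℝ u z c) x a),
      ← hu.fderiv_metric hx (hDu b) (hDu c)]
    have h := (((hg.differentiableAt hx).hasFDerivAt.clm_apply (hasFDerivAt_const b x)).clm_apply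
      (hasFDerivAt_const c x)).fderiv
    change fderiv ℝ (fun z => G (u z) (fderiv ℝ u z b) (fderiv ℝ u z c)) x = _ at h
    rw [h]; simp
  rw [← inducedMetric_apply, hg.koszul hx, key, key, key, hu.covDerivAlong_fderiv_symm hx w v,
    hu.covDerivAlong_fderiv_symm hx v z, hu.covDerivAlong_fderiv_symm hx w z]
  ring

/-- The second fundamental form takes values in the normal bundle. -/
theorem metric_secondFundForm (hu : IsImmersionOn G U u Ω) {x : 𝔼 m} (hx : x ∈ Ω) (v w z : 𝔼 m) :
    G (u x) (secondFundForm G u x v w) (fderiv ℝ u x z) = 0 := by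
  rw [secondFundForm, map_sub, sub_apply,
    hu.metric_covDerivAlong_fderiv hx, sub_self]

theorem metric_tension (hu : IsImmersionOn G U u Ω) {x : 𝔼 m} (hx : x ∈ Ω) (z : 𝔼 m) :
    G (u x) (tension G u x) (fderiv ℝ u x z) = 0 := by
  simp [tension, metricTrace, hu.metric_secondFundForm hx]

theorem inducedMetric_tangentPart (hu : IsImmersionOn G U u Ω) {x : 𝔼 m} (hx : x ∈ Ω) (X : E)
    (v : 𝔼 m) : G (u x) (fderiv ℝ u x (tangentPart G u x X)) (fderiv ℝ u x v)
      = G (u x) X (fderiv ℝ u x v) := by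
  rw [← inducedMetric_apply, tangentPart, (hu.invertible x hx).self_apply_inverse]
  rfl

/-- The gradients of the coordinate functions are smooth. -/
theorem contDiffOn_gradCoord (hu : IsImmersionOn G U u Ω) (i : Fin m) :
    ContDiffOn ℝ ∞ (fun x => (inducedMetric G u x).inverse (EuclideanSpace.proj i)) Ω :=
  (contDiffOn_inverse hu.contDiffOn_inducedMetric hu.invertible).clm_apply contDiffOn_const

theorem contDiffOn_tension [CompleteSpace E] (hu : IsImmersionOn G U u Ω) :
    ContDiffOn ℝ ∞ (tension G u) Ω := by
  unfold tension metricTrace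
  refine ContDiffOn.sum fun i _ => ?_
  have hS := hu.contDiffOn_gradCoord i
  -- the second argument of `h` is not constant, so the derivative of `du` is taken first
  have h1 : ContDiffOn ℝ ∞ (fun x => fderiv ℝ (fderiv ℝ u) x (EuclideanSpace.single i 1)
      ((inducedMetric G u x).inverse (EuclideanSpace.proj i))) Ω :=
    ((hu.contDiffOn_fderiv.fderiv_of_isOpen hu.isOpen (by simp)).clm_apply
      contDiffOn_const).clm_apply hS
  have h2 := (hu.contDiffOn_christoffelL_comp.clm_apply (hu.contDiffOn_fderiv_apply
    (EuclideanSpace.single i 1))).clm_apply (hu.contDiffOn_fderiv.clm_apply hS)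
  have h3 := hu.contDiffOn_fderiv.clm_apply
    ((hu.isMetricOn_inducedMetric.contDiffOn_christoffelL.clm_apply
      (contDiffOn_const (c := EuclideanSpace.single i (1 : ℝ)))).clm_apply hS)
  refine ((h1.add h2).sub h3).congr fun x hx => ?_
  have hD := (hu.differentiableAt_of_contDiffOn hu.contDiffOn_fderiv hx).hasFDerivAt
  simp only [secondFundForm, covDerivAlong, christoffelL_apply]
  rw [(hD.clm_apply (hasFDerivAt_const _ x)).fderiv]
  simp

end IsImmersionOn

end LocalGeom

namespace LocalGeom

variable {E : Type*} [NormedAddCommGroup E] [NormedSpace ℝ E] {m : ℕ}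

local notation "𝔼" m => EuclideanSpace ℝ (Fin m)

/-! ### The tangential part of the bitension field -/

theorem sum_smul_single (v : 𝔼 m) : ∑ i, v i • EuclideanSpace.single i (1 : ℝ) = v := by
  ext j
  simp [Pi.single_apply]

theorem sum_apply_single_mul (A : (𝔼 m) →L[ℝ] ℝ) (v : 𝔼 m) :
    ∑ i, A (EuclideanSpace.single i 1) * v i = A v := by
  conv_rhs => rw [← sum_smul_single v]
  simp [mul_comm]

/-- The second covariant derivative `(∇²V)(v, w) = ∇_v ∇_w V - ∇_{∇_v w} V` of a vector field along
`u`. -/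
def secondCovDeriv (G : E → E →L[ℝ] E →L[ℝ] ℝ) (u V : (𝔼 m) → E) (x v w : 𝔼 m) : E :=
  covDerivAlong G u (fun z => covDerivAlong G u V z w) x v
    - covDerivAlong G u V x (christoffel (inducedMetric G u) x v w)

namespace IsImmersionOn

variable {G : E → E →L[ℝ] E →L[ℝ] ℝ} {U : Set E} {u : (𝔼 m) → E} {Ω : Set (𝔼 m)}

theorem inducedMetric_gradCoord (hu : IsImmersionOn G U u Ω) {x : 𝔼 m} (hx : x ∈ Ω) (i : Fin m)
    (w : 𝔼 m) :
    inducedMetric G u x ((inducedMetric G u x).inverse (EuclideanSpace.proj i)) w = w i := by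
  rw [(hu.invertible x hx).self_apply_inverse]
  rfl

/-- The covariant derivative of the coordinate gradients, `∇_k (grad xⁱ) = -∑ⱼ Γⁱ_kj grad xʲ`. -/
theorem fderiv_gradCoord (hu : IsImmersionOn G U u Ω) {x : 𝔼 m} (hx : x ∈ Ω) (i : Fin m)
    (k : 𝔼 m) :
    fderiv ℝ (fun z => (inducedMetric G u z).inverse (EuclideanSpace.proj i)) x k
      = -christoffel (inducedMetric G u) x k
          ((inducedMetric G u x).inverse (EuclideanSpace.proj i))
        - ∑ j, christoffel (inducedMetric G u) x k (EuclideanSpace.single j 1) i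
          • (inducedMetric G u x).inverse (EuclideanSpace.proj j) := by
  have hg := hu.isMetricOn_inducedMetric
  refine hg.eq_of_forall_apply hx fun z => ?_
  -- differentiate the constant `g (grad xⁱ, z) = zⁱ`
  have hS := (hu.differentiableAt_of_contDiffOn (hu.contDiffOn_gradCoord i) hx).hasFDerivAt
  have h := (((hg.differentiableAt hx).hasFDerivAt.clm_apply hS).clm_apply
    (hasFDerivAt_const z x)).fderiv
  have h0 : fderiv ℝ (fun y => inducedMetric G u y
      ((inducedMetric G u y).inverse (EuclideanSpace.proj i)) z) x = 0 := by
    have : (fun y => inducedMetric G u y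
        ((inducedMetric G u y).inverse (EuclideanSpace.proj i)) z) =ᶠ[𝓝 x] fun _ => z i := by
      filter_upwards [hu.isOpen.mem_nhds hx] with y hy using hu.inducedMetric_gradCoord hy i z
    rw [this.fderiv_eq]
    simp
  rw [h0] at h
  have h1 := DFunLike.congr_fun h k
  simp only [add_apply, ContinuousLinearMap.comp_apply, ContinuousLinearMap.flip_apply,
    hg.fderiv_apply hx, hu.inducedMetric_gradCoord hx, zero_apply, PiLp.zero_apply] at h1
  have h2 := sum_apply_single_mul
    ((EuclideanSpace.proj i).comp (christoffelL (inducedMetric G u) x k)) z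
  simp only [map_sub, map_neg, map_sum, map_smul, sub_apply, neg_apply, sum_apply, smul_apply,
    hu.inducedMetric_gradCoord hx, smul_eq_mul]
  change ∑ j, christoffel (inducedMetric G u) x k (EuclideanSpace.single j 1) i * z j
    = christoffel (inducedMetric G u) x k z i at h2
  rw [h2]
  linarith

/-- For a normal field `V`, `∇V` is dual to the shape operator:
`⟨∇_w V, du k⟩ = -⟨V, ∇_w (du k)⟩`. -/
theorem metric_covDerivAlong_of_normal (hu : IsImmersionOn G U u Ω) {V : (𝔼 m) → E}
    (hV : ContDiffOn ℝ ∞ V Ω) (hn : ∀ x ∈ Ω, ∀ z, G (u x) (V x) (fderiv ℝ u x z) = 0)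
    {x : 𝔼 m} (hx : x ∈ Ω) (w k : 𝔼 m) :
    G (u x) (covDerivAlong G u V x w) (fderiv ℝ u x k)
      = -G (u x) (V x) (covDerivAlong G u (fun z => fderiv ℝ u z k) x w) := by
  have h := hu.fderiv_metric hx (hu.differentiableAt_of_contDiffOn hV hx)
    (hu.differentiableAt_of_contDiffOn (hu.contDiffOn_fderiv_apply k) hx) w
  have h0 : (fun z => G (u z) (V z) (fderiv ℝ u z k)) =ᶠ[𝓝 x] fun _ => 0 := by
    filter_upwards [hu.isOpen.mem_nhds hx] with y hy using hn y hy k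
  rw [h0.fderiv_eq] at h
  simp at h
  linarith

theorem metric_covDerivAlong_comm_of_normal (hu : IsImmersionOn G U u Ω) {V : (𝔼 m) → E}
    (hV : ContDiffOn ℝ ∞ V Ω) (hn : ∀ x ∈ Ω, ∀ z, G (u x) (V x) (fderiv ℝ u x z) = 0)
    {x : 𝔼 m} (hx : x ∈ Ω) (w k : 𝔼 m) :
    G (u x) (covDerivAlong G u V x w) (fderiv ℝ u x k)
      = G (u x) (covDerivAlong G u V x k) (fderiv ℝ u x w) := by
  rw [hu.metric_covDerivAlong_of_normal hV hn hx, hu.metric_covDerivAlong_of_normal hV hn hx,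
    hu.covDerivAlong_fderiv_symm hx]

/-- If `V` is a parallel normal field, `∇V` is tangential and only the tangential part of
`∇_v (du w)` pairs with it. -/
theorem metric_covDerivAlong_covDerivAlong (hu : IsImmersionOn G U u Ω) {V : (𝔼 m) → E}
    {x : 𝔼 m} (hx : x ∈ Ω) {a : 𝔼 m} (hp : ∃ W, covDerivAlong G u V x a = fderiv ℝ u x W)
    (v w : 𝔼 m) :
    G (u x) (covDerivAlong G u V x a) (covDerivAlong G u (fun z => fderiv ℝ u z w) x v)
      = G (u x) (covDerivAlong G u V x a)
          (fderiv ℝ u x (christoffel (inducedMetric G u) x v w)) := by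
  obtain ⟨W, hW⟩ := hp
  rw [hW, hu.isMetricOn.symm _ (hu.mapsTo hx), hu.metric_covDerivAlong_fderiv hx,
    hu.isMetricOn.symm _ (hu.mapsTo hx)]

variable [CompleteSpace E]

/-- For a parallel normal field `V`, the form `⟨(∇²V)(v, w), du k⟩` is symmetric in `w` and `k`. -/
theorem metric_secondCovDeriv_symm (hu : IsImmersionOn G U u Ω) {V : (𝔼 m) → E}
    (hV : ContDiffOn ℝ ∞ V Ω) (hn : ∀ x ∈ Ω, ∀ z, G (u x) (V x) (fderiv ℝ u x z) = 0)
    (hp : ∀ x ∈ Ω, ∀ v, ∃ W, covDerivAlong G u V x v = fderiv ℝ u x W)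
    {x : 𝔼 m} (hx : x ∈ Ω) (v w k : 𝔼 m) :
    G (u x) (secondCovDeriv G u V x v w) (fderiv ℝ u x k)
      = G (u x) (secondCovDeriv G u V x v k) (fderiv ℝ u x w) := by
  have key : ∀ w k, fderiv ℝ (fun z => G (u z) (covDerivAlong G u V z w) (fderiv ℝ u z k)) x v
      = G (u x) (covDerivAlong G u (fun z => covDerivAlong G u V z w) x v) (fderiv ℝ u x k)
        + G (u x) (covDerivAlong G u V x w)
          (fderiv ℝ u x (christoffel (inducedMetric G u) x v k)) := fun w k => by
    rw [hu.fderiv_metric hx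
      (hu.differentiableAt_of_contDiffOn (hu.contDiffOn_covDerivAlong hV w) hx)
      (hu.differentiableAt_of_contDiffOn (hu.contDiffOn_fderiv_apply k) hx),
      hu.metric_covDerivAlong_covDerivAlong hx (hp x hx w)]
  have h : (fun z => G (u z) (covDerivAlong G u V z w) (fderiv ℝ u z k))
      =ᶠ[𝓝 x] fun z => G (u z) (covDerivAlong G u V z k) (fderiv ℝ u z w) := by
    filter_upwards [hu.isOpen.mem_nhds hx] with y hy
      using hu.metric_covDerivAlong_comm_of_normal hV hn hy w k
  have h1 := key w k
  rw [h.fderiv_eq, key k w] at h1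
  simp only [secondCovDeriv, map_sub, sub_apply]
  rw [hu.metric_covDerivAlong_comm_of_normal hV hn hx _ k,
    hu.metric_covDerivAlong_comm_of_normal hV hn hx _ w]
  linarith

/-- The Ricci identity. -/
theorem secondCovDeriv_sub (hu : IsImmersionOn G U u Ω) {V : (𝔼 m) → E}
    (hV : ContDiffOn ℝ ∞ V Ω) {x : 𝔼 m} (hx : x ∈ Ω) (v w : 𝔼 m) :
    secondCovDeriv G u V x v w - secondCovDeriv G u V x w v
      = curvature G (u x) (fderiv ℝ u x v) (fderiv ℝ u x w) (V x) := by
  rw [← hu.covDerivAlong_comm hV hx, secondCovDeriv, secondCovDeriv,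
    hu.isMetricOn_inducedMetric.christoffel_symm hx w v]
  abel

/-- If the mean curvature vector is parallel, then `⟨τ, τ⟩` is constant. -/
theorem fderiv_metric_tension_tension (hu : IsImmersionOn G U u Ω)
    (hp : ∀ x ∈ Ω, ∀ v, ∃ W, covDerivAlong G u (tension G u) x v = fderiv ℝ u x W)
    {x : 𝔼 m} (hx : x ∈ Ω) (k : 𝔼 m) :
    fderiv ℝ (fun z => G (u z) (tension G u z) (tension G u z)) x k = 0 := by
  have hτ := hu.differentiableAt_of_contDiffOn hu.contDiffOn_tension hx
  obtain ⟨W, hW⟩ := hp x hx k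
  rw [hu.fderiv_metric hx hτ hτ, hu.isMetricOn.symm _ (hu.mapsTo hx) _ (tension G u x), hW,
    hu.metric_tension hx, add_zero]

/-- The trace of the shape operator of `τ` is `⟨τ, τ⟩`. -/
theorem sum_metric_covDerivAlong_tension (hu : IsImmersionOn G U u Ω) {x : 𝔼 m} (hx : x ∈ Ω) :
    ∑ i, G (u x) (covDerivAlong G u (tension G u) x (EuclideanSpace.single i 1))
        (fderiv ℝ u x ((inducedMetric G u x).inverse (EuclideanSpace.proj i)))
      = -G (u x) (tension G u x) (tension G u x) := by
  have hn : ∀ x ∈ Ω, ∀ z, G (u x) (tension G u x) (fderiv ℝ u x z) = 0 :=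
    fun x hx z => hu.metric_tension hx z
  conv_rhs => rw [tension, metricTrace, map_sum, ← Finset.sum_neg_distrib, ← metricTrace,
    ← tension]
  refine Finset.sum_congr rfl fun i _ => ?_
  rw [hu.metric_covDerivAlong_of_normal hu.contDiffOn_tension hn hx, secondFundForm, map_sub,
    hu.metric_tension hx, sub_zero]

/-- If `τ` is parallel in the normal bundle, the trace of `⟨(∇²τ)(k, ·), du ·⟩`, which is
`-k ⟨τ, τ⟩`, vanishes. -/
theorem sum_metric_secondCovDeriv_tension (hu : IsImmersionOn G U u Ω)
    (hp : ∀ x ∈ Ω, ∀ v, ∃ W, covDerivAlong G u (tension G u) x v = fderiv ℝ u x W)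
    {x : 𝔼 m} (hx : x ∈ Ω) (k : 𝔼 m) :
    ∑ i, G (u x) (secondCovDeriv G u (tension G u) x k (EuclideanSpace.single i 1))
        (fderiv ℝ u x ((inducedMetric G u x).inverse (EuclideanSpace.proj i))) = 0 := by
  set S : Fin m → (𝔼 m) → 𝔼 m := fun i z => (inducedMetric G u z).inverse (EuclideanSpace.proj i)
    with hS
  have hSd : ∀ i, DifferentiableAt ℝ (S i) x := fun i =>
    hu.differentiableAt_of_contDiffOn (hu.contDiffOn_gradCoord i) hx
  have hDd : ∀ i : Fin m, DifferentiableAt ℝ (fun z => covDerivAlong G u (tension G u) z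
      (EuclideanSpace.single i 1)) x := fun i => hu.differentiableAt_of_contDiffOn
    (hu.contDiffOn_covDerivAlong hu.contDiffOn_tension _) hx
  have hD := hu.differentiableAt_of_contDiffOn hu.contDiffOn_fderiv hx
  have hDS : ∀ i, DifferentiableAt ℝ (fun z => fderiv ℝ u z (S i z)) x := fun i =>
    hD.clm_apply (hSd i)
  have hGd : ∀ i, DifferentiableAt ℝ (fun z => G (u z) (covDerivAlong G u (tension G u) z
      (EuclideanSpace.single i 1)) (fderiv ℝ u z (S i z))) x := fun i =>
    ((hu.differentiableAt_of_contDiffOn hu.contDiffOn_metric hx).clm_apply (hDd i)).clm_apply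
      (hDS i)
  -- differentiate the trace of the shape operator
  have h : (fun z => ∑ i, G (u z) (covDerivAlong G u (tension G u) z (EuclideanSpace.single i 1))
      (fderiv ℝ u z (S i z))) =ᶠ[𝓝 x] fun z => -G (u z) (tension G u z) (tension G u z) := by
    filter_upwards [hu.isOpen.mem_nhds hx] with y hy using hu.sum_metric_covDerivAlong_tension hy
  have h0 := DFunLike.congr_fun (h.fderiv_eq (𝕜 := ℝ)) k
  rw [fderiv_fun_neg, neg_apply, hu.fderiv_metric_tension_tension hp hx, neg_zero,
    fderiv_fun_sum fun i _ => hGd i, sum_apply] at h0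
  have hcov : ∀ i, covDerivAlong G u (fun z => fderiv ℝ u z (S i z)) x k
      = covDerivAlong G u (fun z => fderiv ℝ u z (S i x)) x k
        + fderiv ℝ u x (fderiv ℝ (S i) x k) := fun i => by
    simp only [covDerivAlong]
    rw [(hD.hasFDerivAt.clm_apply (hSd i).hasFDerivAt).fderiv,
      (hD.hasFDerivAt.clm_apply (hasFDerivAt_const (S i x) x)).fderiv]
    simp
    abel
  have hterm : ∀ i : Fin m, fderiv ℝ (fun z => G (u z) (covDerivAlong G u (tension G u) z
      (EuclideanSpace.single i 1)) (fderiv ℝ u z (S i z))) x k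
      = G (u x) (covDerivAlong G u (fun z => covDerivAlong G u (tension G u) z
          (EuclideanSpace.single i 1)) x k) (fderiv ℝ u x (S i x))
        - ∑ j, christoffel (inducedMetric G u) x k (EuclideanSpace.single j 1) i
          * G (u x) (covDerivAlong G u (tension G u) x (EuclideanSpace.single i 1))
              (fderiv ℝ u x (S j x)) := fun i => by
    rw [hu.fderiv_metric hx (hDd i) (hDS i), hcov, map_add,
      hu.metric_covDerivAlong_covDerivAlong hx (hp x hx _), hS]
    simp only [hu.fderiv_gradCoord hx, map_sub, map_neg, map_sum, map_smul, smul_eq_mul]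
    ring
  simp only [hterm, Finset.sum_sub_distrib] at h0
  rw [Finset.sum_comm, ← Finset.sum_sub_distrib] at h0
  rw [← h0]
  refine Finset.sum_congr rfl fun j _ => ?_
  rw [secondCovDeriv, map_sub, sub_apply]
  congr 1
  conv_lhs => rw [← sum_smul_single (christoffel (inducedMetric G u) x k
    (EuclideanSpace.single j 1)), covDerivAlong_sum_smul]
  simp [S]

/-- The tangential part of the bitension field of an immersion with parallel mean curvature vector
is a trace of the curvature of the target. -/
theorem metric_bitension (hu : IsImmersionOn G U u Ω)
    (hp : ∀ x ∈ Ω, ∀ v, ∃ W, covDerivAlong G u (tension G u) x v = fderiv ℝ u x W)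
    {x : 𝔼 m} (hx : x ∈ Ω) (k : 𝔼 m) :
    G (u x) (bitension G u x) (fderiv ℝ u x k)
      = ∑ i, (G (u x) (curvature G (u x) (fderiv ℝ u x (EuclideanSpace.single i 1))
            (fderiv ℝ u x k) (tension G u x))
            (fderiv ℝ u x ((inducedMetric G u x).inverse (EuclideanSpace.proj i)))
          - G (u x) (curvature G (u x) (fderiv ℝ u x (EuclideanSpace.single i 1))
            (tension G u x) (fderiv ℝ u x ((inducedMetric G u x).inverse (EuclideanSpace.proj i))))
            (fderiv ℝ u x k)) := by
  have hn : ∀ x ∈ Ω, ∀ z, G (u x) (tension G u x) (fderiv ℝ u x z) = 0 :=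
    fun x hx z => hu.metric_tension hx z
  have hτ := hu.contDiffOn_tension
  have h := hu.sum_metric_secondCovDeriv_tension hp hx k
  rw [bitension, map_sub, sub_apply, Finset.sum_sub_distrib]
  congr 1
  · rw [roughLaplacian, metricTrace, map_sum, sum_apply, ← sub_zero (Finset.sum _ _), ← h,
      ← Finset.sum_sub_distrib]
    refine Finset.sum_congr rfl fun i _ => ?_
    rw [← secondCovDeriv, hu.metric_secondCovDeriv_symm hτ hn hp hx, ← sub_apply, ← map_sub,
      hu.secondCovDeriv_sub hτ hx]
  · simp [metricTrace]

end IsImmersionOn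
end LocalGeom

/-! ### The Robertson-Walker metric in stereographic coordinates -/

namespace RobertsonWalker

open LocalGeom

variable {V : Type*} [NormedAddCommGroup V] [InnerProductSpace ℝ V]

local notation "⟪" x ", " y "⟫" => inner ℝ x y

/-- The conformal factor of the space form of curvature `c` in stereographic coordinates. -/
def confFactor (c : ℝ) (p : V) : ℝ := (1 + c * ‖p‖ ^ 2 / 4)⁻¹

/-- The form `-dt² + (f λ)² |dp|²` on `ℝ × V`. -/
def coordForm (f : ℝ → ℝ) (c : ℝ) (y : ℝ × V) : (ℝ × V) →L[ℝ] (ℝ × V) →L[ℝ] ℝ :=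
  (f y.1 * confFactor c y.2) ^ 2 • ((innerSL ℝ : V →L[ℝ] V →L[ℝ] ℝ).bilinearComp
      (ContinuousLinearMap.snd ℝ ℝ V) (ContinuousLinearMap.snd ℝ ℝ V) :
        (ℝ × V) →L[ℝ] (ℝ × V) →L[ℝ] ℝ)
    - (ContinuousLinearMap.mul ℝ ℝ).bilinearComp (ContinuousLinearMap.fst ℝ ℝ V)
      (ContinuousLinearMap.fst ℝ ℝ V)

theorem coordForm_apply (f : ℝ → ℝ) (c : ℝ) (y v w : ℝ × V) :
    coordForm f c y v w = (f y.1 * confFactor c y.2) ^ 2 * ⟪v.2, w.2⟫ - v.1 * w.1 := rfl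

/-- `G` is the Robertson-Walker metric on the open set `U` of `ℝ × V`, in the coordinates given by
`t` and a stereographic projection; the warping function `f` is smooth and does not vanish. -/
structure IsCoordMetric (f : ℝ → ℝ) (c : ℝ) (G : (ℝ × V) → (ℝ × V) →L[ℝ] (ℝ × V) →L[ℝ] ℝ)
    (I : Set ℝ) (U : Set (ℝ × V)) : Prop where
  isOpen_interval : IsOpen I
  contDiffOn : ContDiffOn ℝ ∞ f I
  ne_zero : ∀ t ∈ I, f t ≠ 0
  isOpen : IsOpen U
  fst_mem : ∀ y ∈ U, y.1 ∈ I
  pos : ∀ y ∈ U, 0 < 1 + c * ‖y.2‖ ^ 2 / 4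
  eqOn : EqOn G (coordForm f c) U

theorem hasFDerivAt_confFactor {c : ℝ} {p : V} (hp : 0 < 1 + c * ‖p‖ ^ 2 / 4) :
    HasFDerivAt (confFactor c) ((-(c / 2) * confFactor c p ^ 2) • innerSL ℝ p) p := by
  have h0 := (((hasStrictFDerivAt_norm_sq p).hasFDerivAt.const_mul c).mul_const (4⁻¹ : ℝ)).const_add
    1
  rw [div_eq_mul_inv] at hp
  refine (((hasDerivAt_inv hp.ne').comp_hasFDerivAt p h0).congr_fderiv
    ?_).congr_of_eventuallyEq (.of_forall fun x => ?_)
  · ext x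
    simp [confFactor, div_eq_mul_inv]
    ring
  · simp [confFactor, div_eq_mul_inv]

namespace IsCoordMetric

variable {f : ℝ → ℝ} {c : ℝ} {G : (ℝ × V) → (ℝ × V) →L[ℝ] (ℝ × V) →L[ℝ] ℝ} {I : Set ℝ}
  {U : Set (ℝ × V)}

theorem confFactor_pos (h : IsCoordMetric f c G I U) {y : ℝ × V} (hy : y ∈ U) :
    0 < confFactor c y.2 := inv_pos.mpr (h.pos y hy)

theorem mul_sq_pos (h : IsCoordMetric f c G I U) {y : ℝ × V} (hy : y ∈ U) :
    0 < (f y.1 * confFactor c y.2) ^ 2 :=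
  sq_pos_of_ne_zero (mul_ne_zero (h.ne_zero _ (h.fst_mem y hy)) (h.confFactor_pos hy).ne')

theorem apply (h : IsCoordMetric f c G I U) {y : ℝ × V} (hy : y ∈ U) (v w : ℝ × V) :
    G y v w = (f y.1 * confFactor c y.2) ^ 2 * ⟪v.2, w.2⟫ - v.1 * w.1 := by
  rw [h.eqOn hy, coordForm_apply]

theorem hasDerivAt (h : IsCoordMetric f c G I U) {y : ℝ × V} (hy : y ∈ U) :
    HasDerivAt f (deriv f y.1) y.1 :=
  ((h.contDiffOn.contDiffAt (h.isOpen_interval.mem_nhds (h.fst_mem y hy))).differentiableAt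
    (by simp)).hasDerivAt

theorem hasDerivAt_deriv (h : IsCoordMetric f c G I U) {y : ℝ × V} (hy : y ∈ U) :
    HasDerivAt (deriv f) (deriv (deriv f) y.1) y.1 :=
  (((h.contDiffOn.deriv_of_isOpen h.isOpen_interval (m := ∞) (by simp)).contDiffAt
    (h.isOpen_interval.mem_nhds (h.fst_mem y hy))).differentiableAt (by simp)).hasDerivAt

theorem eq_of_forall_apply (h : IsCoordMetric f c G I U) {y : ℝ × V} (hy : y ∈ U) {v w : ℝ × V}
    (hvw : ∀ z, G y v z = G y w z) : v = w := by
  simp only [h.apply hy] at hvw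
  have h1 : v.1 = w.1 := by simpa using hvw (1, 0)
  refine Prod.ext h1 (ext_inner_right ℝ fun z => ?_)
  simpa [(h.mul_sq_pos hy).ne', h1] using hvw (0, z)

theorem isMetricOn [FiniteDimensional ℝ V] (h : IsCoordMetric f c G I U) : IsMetricOn G U where
  isOpen := h.isOpen
  contDiffOn := by
    have hn : ContDiff ℝ ∞ fun y : ℝ × V => 1 + c * ‖y.2‖ ^ 2 / 4 :=
      contDiff_const.add ((contDiff_const.mul ((contDiff_norm_sq ℝ).comp contDiff_snd)).div_const _)
    have hf : ContDiffOn ℝ ∞ (fun y : ℝ × V => f y.1) U :=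
      h.contDiffOn.comp contDiff_fst.contDiffOn h.fst_mem
    refine ContDiffOn.congr ?_ h.eqOn
    exact (((hf.mul (hn.contDiffOn.inv fun y hy => (h.pos y hy).ne')).pow 2).smul
      contDiffOn_const).sub contDiffOn_const
  symm y hy v w := by
    rw [h.apply hy, h.apply hy, real_inner_comm]
    ring
  invertible y hy := isInvertible_of_injective _ fun v w hvw =>
    h.eq_of_forall_apply hy fun z => by rw [hvw]

theorem fderiv_apply [FiniteDimensional ℝ V] (h : IsCoordMetric f c G I U) {y : ℝ × V} (hy : y ∈ U)
    (v w z : ℝ × V) :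
    fderiv ℝ G y v w z = 2 * (f y.1 * confFactor c y.2) * (deriv f y.1 * v.1 * confFactor c y.2
      + f y.1 * (-(c / 2) * confFactor c y.2 ^ 2 * ⟪y.2, v.2⟫)) * ⟪w.2, z.2⟫ := by
  have h1 := ((h.isMetricOn.differentiableAt hy).hasFDerivAt.clm_apply
    (hasFDerivAt_const w y)).clm_apply (hasFDerivAt_const z y)
  have h2 : fderiv ℝ (fun x => G x w z) y v = fderiv ℝ G y v w z := by rw [h1.fderiv]; simp
  have h3 : (fun x => G x w z) =ᶠ[𝓝 y]
      fun x => (f x.1 * confFactor c x.2) ^ 2 * ⟪w.2, z.2⟫ - w.1 * z.1 := by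
    filter_upwards [h.isOpen.mem_nhds hy] with x hx using h.apply hx w z
  have hf := (h.hasDerivAt hy).comp_hasFDerivAt y (hasFDerivAt_fst (𝕜 := ℝ) (p := y))
  have hl := (hasFDerivAt_confFactor (h.pos y hy)).comp y (hasFDerivAt_snd (𝕜 := ℝ) (p := y))
  have h4 := (((hf.mul hl).pow 2).mul_const ⟪w.2, z.2⟫).sub_const (w.1 * z.1)
  rw [← h2, h3.fderiv_eq]
  refine (DFunLike.congr_fun h4.fderiv v).trans ?_
  simp
  ring

/-- The Christoffel symbols of the Robertson-Walker metric. -/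
theorem christoffel_eq [FiniteDimensional ℝ V] (h : IsCoordMetric f c G I U) {y : ℝ × V}
    (hy : y ∈ U) (v w : ℝ × V) :
    christoffel G y v w = (f y.1 * deriv f y.1 * (confFactor c y.2 ^ 2 * ⟪v.2, w.2⟫),
      (deriv f y.1 / f y.1) • (v.1 • w.2 + w.1 • v.2)
        - (c / 2 * confFactor c y.2) •
          (⟪y.2, v.2⟫ • w.2 + ⟪y.2, w.2⟫ • v.2 - ⟪v.2, w.2⟫ • y.2)) := by
  refine h.eq_of_forall_apply hy fun z => ?_
  rw [h.isMetricOn.koszul hy, h.fderiv_apply hy, h.fderiv_apply hy, h.fderiv_apply hy, h.apply hy]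
  have hf := h.ne_zero _ (h.fst_mem y hy)
  simp only [inner_add_left, inner_sub_left, real_inner_smul_left]
  field_simp
  ring

/-- The curvature tensor of the Robertson-Walker metric. -/
theorem curvature_eq [FiniteDimensional ℝ V] (h : IsCoordMetric f c G I U) {y : ℝ × V}
    (hy : y ∈ U) (a b w : ℝ × V) :
    curvature G y a b w = (f y.1 * deriv (deriv f) y.1 * confFactor c y.2 ^ 2 *
        (⟪b.2, w.2⟫ * a.1 - ⟪a.2, w.2⟫ * b.1),
      (deriv (deriv f) y.1 / f y.1 * w.1) • (a.1 • b.2 - b.1 • a.2)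
        + ((deriv f y.1 ^ 2 + c) * confFactor c y.2 ^ 2) •
          (⟪b.2, w.2⟫ • a.2 - ⟪a.2, w.2⟫ • b.2)) := by
  have hf0 := h.ne_zero _ (h.fst_mem y hy)
  have hf := (h.hasDerivAt hy).comp_hasFDerivAt y (hasFDerivAt_fst (𝕜 := ℝ) (p := y))
  have hf' := (h.hasDerivAt_deriv hy).comp_hasFDerivAt y (hasFDerivAt_fst (𝕜 := ℝ) (p := y))
  have hl := (hasFDerivAt_confFactor (h.pos y hy)).comp y (hasFDerivAt_snd (𝕜 := ℝ) (p := y))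
  have hq := ((h.hasDerivAt_deriv hy).div (h.hasDerivAt hy) hf0).comp_hasFDerivAt y
    (hasFDerivAt_fst (𝕜 := ℝ) (p := y))
  have hs : HasFDerivAt (fun x : ℝ × V => x.2) (ContinuousLinearMap.snd ℝ ℝ V) y := hasFDerivAt_snd
  have key : ∀ a b w : ℝ × V, fderiv ℝ (fun z => christoffel G z b w) y a =
      ((deriv f y.1 ^ 2 + f y.1 * deriv (deriv f) y.1) * a.1 * (confFactor c y.2 ^ 2 * ⟪b.2, w.2⟫)
        + f y.1 * deriv f y.1 *
          (2 * confFactor c y.2 * (-(c / 2) * confFactor c y.2 ^ 2 * ⟪y.2, a.2⟫) * ⟪b.2, w.2⟫),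
      ((deriv (deriv f) y.1 * f y.1 - deriv f y.1 ^ 2) / f y.1 ^ 2 * a.1) •
          (b.1 • w.2 + w.1 • b.2)
        - ((c / 2 * (-(c / 2) * confFactor c y.2 ^ 2 * ⟪y.2, a.2⟫)) •
          (⟪y.2, b.2⟫ • w.2 + ⟪y.2, w.2⟫ • b.2 - ⟪b.2, w.2⟫ • y.2)
        + (c / 2 * confFactor c y.2) •
          (⟪a.2, b.2⟫ • w.2 + ⟪a.2, w.2⟫ • b.2 - ⟪b.2, w.2⟫ • a.2))) := by
    intro a b w
    have h3 : (fun z => christoffel G z b w) =ᶠ[𝓝 y] fun z =>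
        (f z.1 * deriv f z.1 * (confFactor c z.2 ^ 2 * ⟪b.2, w.2⟫),
          (deriv f z.1 / f z.1) • (b.1 • w.2 + w.1 • b.2)
          - (c / 2 * confFactor c z.2) •
            (⟪z.2, b.2⟫ • w.2 + ⟪z.2, w.2⟫ • b.2 - ⟪b.2, w.2⟫ • z.2)) := by
      filter_upwards [h.isOpen.mem_nhds hy] with x hx using h.christoffel_eq hx b w
    have hi : ∀ k : V, HasFDerivAt (fun x : ℝ × V => ⟪x.2, k⟫)
        ((innerSL ℝ k).comp (ContinuousLinearMap.snd ℝ ℝ V)) y := fun k => by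
      have := (innerSL ℝ k).hasFDerivAt.comp y hs
      refine this.congr_of_eventuallyEq (.of_forall fun x => ?_)
      simp [real_inner_comm]
    have h4 := ((hf.mul hf').mul ((hl.pow 2).mul_const ⟪b.2, w.2⟫)).prodMk
      ((hq.smul_const (b.1 • w.2 + w.1 • b.2)).sub ((hl.const_mul (c / 2)).smul
        ((((hi b.2).smul_const w.2).add ((hi w.2).smul_const b.2)).sub (hs.const_smul ⟪b.2, w.2⟫))))
    rw [h3.fderiv_eq]
    refine (DFunLike.congr_fun h4.fderiv a).trans (Prod.ext ?_ ?_)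
    · simp
      ring
    · simp [real_inner_comm]
      module
  have hk : c * ‖y.2‖ ^ 2 / 4 * confFactor c y.2 = 1 - confFactor c y.2 := by
    rw [confFactor]
    linear_combination mul_inv_cancel₀ (h.pos y hy).ne'
  rw [curvature, key, key]
  simp only [h.christoffel_eq hy]
  generalize confFactor c y.2 = l at *
  refine Prod.ext ?_ ?_
  · simp only [Prod.fst_add, Prod.fst_sub, inner_add_right, inner_sub_right, real_inner_smul_right]
    simp only [real_inner_comm]
    field_simp
    ring
  · simp only [Prod.snd_add, Prod.snd_sub, inner_add_right, inner_sub_right, real_inner_smul_right]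
    obtain ⟨r, hr⟩ : ∃ r, deriv f y.1 = r * f y.1 := ⟨_, (div_mul_cancel₀ _ hf0).symm⟩
    obtain ⟨s, hs⟩ : ∃ s, deriv (deriv f) y.1 = s * f y.1 := ⟨_, (div_mul_cancel₀ _ hf0).symm⟩
    rw [hr, hs]
    have e : (s * f y.1 * f y.1 - (r * f y.1) ^ 2) / f y.1 ^ 2 = s - r ^ 2 := by field_simp
    simp only [e, mul_div_cancel_right₀ _ hf0, real_inner_self_eq_norm_sq, real_inner_comm]
    linear_combination (norm := module) (-hk) • ((c * l) • (⟪b.2, w.2⟫ • a.2 - ⟪a.2, w.2⟫ • b.2))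

end IsCoordMetric
end RobertsonWalker

/-! ### Biconservative immersions in Robertson-Walker spaces -/

namespace LocalGeom

variable {E : Type*} [NormedAddCommGroup E] [NormedSpace ℝ E] {m : ℕ}

local notation "𝔼" m => EuclideanSpace ℝ (Fin m)

namespace IsImmersionOn

variable {G : E → E →L[ℝ] E →L[ℝ] ℝ} {U : Set E} {u : (𝔼 m) → E} {Ω : Set (𝔼 m)}

theorem sum_inducedMetric_smul_gradCoord (hu : IsImmersionOn G U u Ω) {x : 𝔼 m} (hx : x ∈ Ω)
    (k : 𝔼 m) :
    ∑ i, inducedMetric G u x k (EuclideanSpace.single i 1)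
      • (inducedMetric G u x).inverse (EuclideanSpace.proj i) = k := by
  refine hu.isMetricOn_inducedMetric.eq_of_forall_apply hx fun z => ?_
  rw [← sum_apply_single_mul (inducedMetric G u x k) z]
  simp [hu.inducedMetric_gradCoord hx]

theorem tension_eq_smul_meanCurv (hm : m ≠ 0) (x : 𝔼 m) :
    tension G u x = (m : ℝ) • meanCurv G u x := by
  rw [meanCurv, smul_smul, mul_one_div_cancel (by exact_mod_cast hm), one_smul, tension]

/-- If the mean curvature vector is parallel, the derivative of the tension field is tangential. -/
theorem exists_covDerivAlong_tension_eq [CompleteSpace E] (hu : IsImmersionOn G U u Ω) (hm : m ≠ 0)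
    {x : 𝔼 m} (hx : x ∈ Ω) {v : 𝔼 m} (h : normalCovDeriv G u (meanCurv G u) x v = 0) :
    ∃ W, covDerivAlong G u (tension G u) x v = fderiv ℝ u x W := by
  have hτ := hu.differentiableAt_of_contDiffOn hu.contDiffOn_tension hx
  have hH : meanCurv G u = fun z => (1 / (m : ℝ)) • tension G u z := rfl
  refine ⟨(m : ℝ) • tangentPart G u x (covDerivAlong G u (meanCurv G u) x v), ?_⟩
  rw [normalCovDeriv, normalPart, sub_eq_zero] at h
  rw [map_smul, ← h, hH, covDerivAlong_const_smul G u hτ, smul_smul,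
    mul_one_div_cancel (by exact_mod_cast hm), one_smul]

end IsImmersionOn
end LocalGeom

namespace RobertsonWalker

open LocalGeom

variable {V : Type*} [NormedAddCommGroup V] [InnerProductSpace ℝ V]

local notation "⟪" x ", " y "⟫" => inner ℝ x y

namespace IsCoordMetric

variable {f : ℝ → ℝ} {c : ℝ} {G : (ℝ × V) → (ℝ × V) →L[ℝ] (ℝ × V) →L[ℝ] ℝ} {I : Set ℝ}
  {U : Set (ℝ × V)}

/-- The curvature tensor of the Robertson-Walker metric, with all indices lowered. -/
theorem metric_curvature [FiniteDimensional ℝ V] (h : IsCoordMetric f c G I U)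
    {y : ℝ × V} (hy : y ∈ U) (a b w z : ℝ × V) :
    G y (curvature G y a b w) z = (deriv f y.1 ^ 2 + c) / f y.1 ^ 2
        * (G y b w * G y a z - G y a w * G y b z)
      + (deriv (deriv f) y.1 / f y.1 - (deriv f y.1 ^ 2 + c) / f y.1 ^ 2)
        * (w.1 * (a.1 * G y b z - b.1 * G y a z) - z.1 * (a.1 * G y b w - b.1 * G y a w)) := by
  have hf0 := h.ne_zero _ (h.fst_mem y hy)
  rw [h.curvature_eq hy]
  simp only [h.apply hy, inner_add_left, inner_sub_left, real_inner_smul_left]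
  field_simp
  ring

variable {m : ℕ} {u : EuclideanSpace ℝ (Fin m) → ℝ × V} {Ω : Set (EuclideanSpace ℝ (Fin m))}

/-- The tangential part of the bitension field of an immersion with parallel mean curvature vector
in a Robertson-Walker space is a multiple of `⟨τ, ∂/∂t⟩ T`. -/
theorem metric_bitension [FiniteDimensional ℝ V] (h : IsCoordMetric f c G I U)
    (hu : IsImmersionOn G U u Ω)
    (hp : ∀ x ∈ Ω, ∀ v, ∃ W, covDerivAlong G u (tension G u) x v = fderiv ℝ u x W)
    {x : EuclideanSpace ℝ (Fin m)} (hx : x ∈ Ω) (k : EuclideanSpace ℝ (Fin m)) :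
    G (u x) (bitension G u x) (fderiv ℝ u x k) = 2 * (1 - (m : ℝ))
      * (deriv (deriv f) (u x).1 / f (u x).1 - (deriv f (u x).1 ^ 2 + c) / f (u x).1 ^ 2)
      * (tension G u x).1 * (fderiv ℝ u x k).1 := by
  have hy := hu.mapsTo hx
  have hs := hu.isMetricOn.symm (u x) hy
  have hn : ∀ z, G (u x) (fderiv ℝ u x z) (tension G u x) = 0 := fun z => by
    rw [hs, hu.metric_tension hx]
  have hS : ∀ i z, G (u x) (fderiv ℝ u x z)
      (fderiv ℝ u x ((inducedMetric G u x).inverse (EuclideanSpace.proj i))) = z i := fun i z => by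
    rw [hs]
    exact hu.inducedMetric_gradCoord hx i z
  rw [hu.metric_bitension hp hx]
  simp only [h.metric_curvature hy, hn, hu.metric_tension hx, hS]
  generalize deriv (deriv f) (u x).1 / f (u x).1 - (deriv f (u x).1 ^ 2 + c) / f (u x).1 ^ 2 = B
  have h1 := sum_apply_single_mul ((ContinuousLinearMap.fst ℝ ℝ V).comp (fderiv ℝ u x)) k
  have h2 := congr_arg (fun z => (fderiv ℝ u x z).1)
    (hu.sum_inducedMetric_smul_gradCoord hx k)
  simp only [map_sum, map_smul, Prod.fst_sum, Prod.smul_fst, inducedMetric_apply, smul_eq_mul,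
    hs (fderiv ℝ u x k)] at h2
  simp only [ContinuousLinearMap.comp_apply, ContinuousLinearMap.coe_fst'] at h1
  calc _ = ∑ i, (B * (tension G u x).1 * ((fderiv ℝ u x (EuclideanSpace.single i 1)).1 * k i)
        + B * (tension G u x).1 * (G (u x) (fderiv ℝ u x (EuclideanSpace.single i 1))
          (fderiv ℝ u x k) *
            (fderiv ℝ u x ((inducedMetric G u x).inverse (EuclideanSpace.proj i))).1)
        - 2 * B * (tension G u x).1 * (fderiv ℝ u x k).1) := by
        refine Finset.sum_congr rfl fun i _ => ?_
        simp
        ring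
    _ = _ := by
        rw [Finset.sum_sub_distrib, Finset.sum_add_distrib, ← Finset.mul_sum, ← Finset.mul_sum, h1,
          h2]
        simp
        ring

/-- The mean curvature vector of a biconservative immersion with parallel mean curvature vector is
orthogonal to `∂/∂t` wherever the tangential part of `∂/∂t` does not vanish. -/
theorem meanCurv_fst_eq_zero [FiniteDimensional ℝ V] (h : IsCoordMetric f c G I U)
    (hu : IsImmersionOn G U u Ω) (hm : 2 ≤ m)
    (hp : ∀ x ∈ Ω, ∀ v, normalCovDeriv G u (meanCurv G u) x v = 0)
    {x : EuclideanSpace ℝ (Fin m)} (hx : x ∈ Ω)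
    (hcurv : deriv (deriv f) (u x).1 / f (u x).1
      - (deriv f (u x).1 ^ 2 + c) / f (u x).1 ^ 2 ≠ 0)
    (hpos : ∀ v, v ≠ 0 → 0 < G (u x) (fderiv ℝ u x v) (fderiv ℝ u x v))
    (hT : tangentPart G u x (1, 0) ≠ 0) (hb : tangentPart G u x (bitension G u x) = 0) :
    (meanCurv G u x).1 = 0 := by
  have hm' : (2 : ℝ) ≤ m := by exact_mod_cast hm
  have h1 := h.metric_bitension hu (fun x hx v =>
    hu.exists_covDerivAlong_tension_eq (by omega) hx (hp x hx v)) hx (tangentPart G u x (1, 0))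
  rw [← hu.inducedMetric_tangentPart hx, hb, map_zero, map_zero, zero_apply,
    IsImmersionOn.tension_eq_smul_meanCurv (by omega)] at h1
  have h2 := hpos _ hT
  rw [hu.inducedMetric_tangentPart hx, h.apply (hu.mapsTo hx)] at h2
  simp only [inner_zero_left, mul_zero, one_mul, zero_sub, Left.neg_pos_iff] at h2
  have h3 : (1 - (m : ℝ)) ≠ 0 := by linarith
  have h4 : (m : ℝ) ≠ 0 := by linarith
  simpa [h2.ne, h3, h4, hcurv] using h1

theorem metric_meanCurv_normalPart (h : IsCoordMetric f c G I U) (hu : IsImmersionOn G U u Ω)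
    (hm : m ≠ 0) {x : EuclideanSpace ℝ (Fin m)} (hx : x ∈ Ω) (h0 : (meanCurv G u x).1 = 0) :
    G (u x) (meanCurv G u x) (normalPart G u x (1, 0)) = 0 := by
  have h1 := hu.metric_tension hx (tangentPart G u x (1, 0))
  rw [IsImmersionOn.tension_eq_smul_meanCurv hm, map_smul, smul_apply, smul_eq_mul] at h1
  rw [normalPart, map_sub, (mul_eq_zero.mp h1).resolve_left (by exact_mod_cast hm),
    h.apply (hu.mapsTo hx)]
  simp [h0]

/-- A vector orthogonal to `∂/∂t` is space-like. -/
theorem pos_or_eq_zero (h : IsCoordMetric f c G I U) {y : ℝ × V} (hy : y ∈ U) {v : ℝ × V}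
    (hv : v.1 = 0) : 0 < G y v v ∨ v = 0 := by
  rcases eq_or_ne v.2 0 with h2 | h2
  · exact .inr (Prod.ext hv h2)
  · left
    rw [h.apply hy, hv, mul_zero, sub_zero]
    exact mul_pos (h.mul_sq_pos hy) (real_inner_self_pos.mpr h2)

end IsCoordMetric
end RobertsonWalker

/-! ### Maps read in charts -/

theorem isOpen_chartDomain {m : ℕ} {M H N : Type*} [TopologicalSpace M] [TopologicalSpace H]
    [TopologicalSpace N] {φ : M → N} {e : OpenPartialHomeomorph M (EuclideanSpace ℝ (Fin m))}
    {e' : OpenPartialHomeomorph N H} (hφ : Continuous φ) : IsOpen (chartDomain φ e e') :=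
  e.symm.isOpen_inter_preimage (e'.open_source.preimage hφ)

section Charts

variable {m : ℕ} {M : Type*} [TopologicalSpace M] [ChartedSpace (EuclideanSpace ℝ (Fin m)) M]
  [IsManifold 𝓘(ℝ, EuclideanSpace ℝ (Fin m)) ∞ M]
  {E : Type*} [NormedAddCommGroup E] [NormedSpace ℝ E] {H : Type*} [TopologicalSpace H]
  {J : ModelWithCorners ℝ E H} {N : Type*} [TopologicalSpace N] [ChartedSpace H N]
  [IsManifold J ∞ N] {φ : M → N} {e : OpenPartialHomeomorph M (EuclideanSpace ℝ (Fin m))}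
  {e' : OpenPartialHomeomorph N H}

theorem contDiffOn_mapInChart (hφ : ContMDiff 𝓘(ℝ, EuclideanSpace ℝ (Fin m)) J ∞ φ)
    (he : e ∈ atlas (EuclideanSpace ℝ (Fin m)) M) (he' : e' ∈ atlas H N) :
    ContDiffOn ℝ ∞ (mapInChart J φ e e') (chartDomain φ e e') := by
  rw [← contMDiffOn_iff_contDiffOn]
  have h1 := contMDiffOn_symm_of_mem_maximalAtlas (n := ∞)
    (IsManifold.subset_maximalAtlas (I := 𝓘(ℝ, EuclideanSpace ℝ (Fin m))) he)
  have h2 := e'.contMDiffOn_extend (n := ∞) (IsManifold.subset_maximalAtlas (I := J) he')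
  exact h2.comp (hφ.comp_contMDiffOn (h1.mono fun x hx => hx.1)) fun x hx => hx.2

/-- A space-like map read in charts has a positive definite first fundamental form. -/
theorem IsSpacelike.pos [J.Boundaryless]
    {g : ∀ p : N, TangentSpace J p →L[ℝ] TangentSpace J p →L[ℝ] ℝ}
    (hs : IsSpacelike m J g φ) (hφ : ContMDiff 𝓘(ℝ, EuclideanSpace ℝ (Fin m)) J ∞ φ)
    (he : e ∈ atlas (EuclideanSpace ℝ (Fin m)) M) (he' : e' ∈ atlas H N)
    {x : EuclideanSpace ℝ (Fin m)} (hx : x ∈ chartDomain φ e e') {v : EuclideanSpace ℝ (Fin m)}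
    (hv : v ≠ 0) :
    0 < metricInChart J g e' (mapInChart J φ e e' x) (fderiv ℝ (mapInChart J φ e e') x v)
      (fderiv ℝ (mapInChart J φ e e') x v) := by
  have hu : MDifferentiableAt 𝓘(ℝ, EuclideanSpace ℝ (Fin m)) 𝓘(ℝ, E) (mapInChart J φ e e') x :=
    (((contDiffOn_mapInChart hφ he he').contDiffAt
      ((isOpen_chartDomain hφ.continuous).mem_nhds hx)).differentiableAt
        (by simp)).mdifferentiableAt
  have hinv : (e'.extend J).symm (mapInChart J φ e e' x) = φ (e.symm x) :=
    e'.extend_left_inv hx.2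
  have hA : MDifferentiableAt 𝓘(ℝ, E) J (e'.extend J).symm (mapInChart J φ e e' x) := by
    have h := contMDiffOn_extend_symm (n := ∞) (IsManifold.subset_maximalAtlas (I := J) he')
    refine (h.contMDiffAt ?_).mdifferentiableAt (by simp)
    exact (J.toHomeomorph.isOpenMap _ e'.open_target).mem_nhds
      (mem_image_of_mem _ (e'.map_source hx.2))
  have hS := (contMDiffOn_symm_of_mem_maximalAtlas (n := ∞)
    (IsManifold.subset_maximalAtlas (I := 𝓘(ℝ, EuclideanSpace ℝ (Fin m))) he)).contMDiffAt
      (e.open_target.mem_nhds hx.1) |>.mdifferentiableAt (by simp)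
  have hP := hφ.mdifferentiableAt (x := e.symm x) (by simp)
  have hcomp : (e'.extend J).symm ∘ mapInChart J φ e e' =ᶠ[𝓝 x] φ ∘ e.symm := by
    filter_upwards [(isOpen_chartDomain hφ.continuous).mem_nhds hx] with z hz
      using e'.extend_left_inv hz.2
  have h1 := mfderiv_comp x hA hu
  rw [hcomp.mfderiv_eq, mfderiv_comp x hP hS, mfderiv_eq_fderiv] at h1
  have hinj : mfderiv 𝓘(ℝ, EuclideanSpace ℝ (Fin m)) 𝓘(ℝ, EuclideanSpace ℝ (Fin m)) e.symm x v
      ≠ 0 := by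
    intro h0
    have h2 := (mdifferentiable_of_mem_atlas (I := 𝓘(ℝ, EuclideanSpace ℝ (Fin m)))
      he).comp_symm_deriv hx.1
    have h3 : mfderiv 𝓘(ℝ, EuclideanSpace ℝ (Fin m)) 𝓘(ℝ, EuclideanSpace ℝ (Fin m)) e (e.symm x)
        (mfderiv 𝓘(ℝ, EuclideanSpace ℝ (Fin m)) 𝓘(ℝ, EuclideanSpace ℝ (Fin m)) e.symm x v) = v :=
      DFunLike.congr_fun h2 v
    rw [h0, map_zero] at h3
    exact hv h3.symm
  have h4 := hs (e.symm x) _ hinj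
  -- the tangent spaces at the two names of the point `φ (e.symm x)` are both `E`
  have h5 : ∀ p : N, p = φ (e.symm x) → ∀ w : E,
      w = mfderiv 𝓘(ℝ, EuclideanSpace ℝ (Fin m)) J φ (e.symm x)
        (mfderiv 𝓘(ℝ, EuclideanSpace ℝ (Fin m)) 𝓘(ℝ, EuclideanSpace ℝ (Fin m)) e.symm x v) →
      0 < (g p : E →L[ℝ] E →L[ℝ] ℝ) w w := by
    rintro _ rfl _ rfl
    exact h4
  exact h5 _ hinv _ (DFunLike.congr_fun h1 v).symm

end Charts

/-! ### The charts of a Robertson-Walker space -/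

namespace SpaceForm

variable {m : ℕ} {c : ℝ}

local notation "⟪" x ", " y "⟫" => inner ℝ x y

open RobertsonWalker in
/-- Inverse stereographic projection is conformal. -/
theorem ambientForm_fderiv_stereoInv (hc : c = 1 ∨ c = 0 ∨ c = -1) {ε : ℝ} (hε : ε ^ 2 = 1)
    {p : EuclideanSpace ℝ (Fin m)} (hp : 0 < 1 + c * ‖p‖ ^ 2 / 4)
    (v w : EuclideanSpace ℝ (Fin m)) :
    ambientForm m c (fderiv ℝ (stereoInv c ε) p v) (fderiv ℝ (stereoInv c ε) p w)
      = confFactor c p ^ 2 * ⟪v, w⟫ := by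
  have hl := hasFDerivAt_confFactor hp
  have h1 : stereoInv c ε =ᶠ[𝓝 p] fun x => (ε * (2 * confFactor c x - 1), confFactor c x • x) := by
    have : IsOpen {w : EuclideanSpace ℝ (Fin m) | 0 < 1 + c * ‖w‖ ^ 2 / 4} :=
      isOpen_lt continuous_const (by fun_prop)
    filter_upwards [this.mem_nhds hp] with x hx
    refine Prod.ext ?_ rfl
    have hx' : 1 + c * ‖x‖ ^ 2 / 4 ≠ 0 := ne_of_gt hx
    simp only [stereoInv, confFactor]
    generalize c * ‖x‖ ^ 2 / 4 = s at *
    field_simp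
    ring
  have h2 := (((hl.const_mul 2).sub_const 1).const_mul ε).prodMk (hl.smul (hasFDerivAt_id p))
  have h3 : ∀ x, fderiv ℝ (stereoInv c ε) p x
      = (ε * (2 * (-(c / 2) * confFactor c p ^ 2 * ⟪p, x⟫)),
        confFactor c p • x + (-(c / 2) * confFactor c p ^ 2 * ⟪p, x⟫) • p) := fun x => by
    rw [h1.fderiv_eq]
    refine (DFunLike.congr_fun h2.fderiv x).trans ?_
    simp
  have hk : c * ‖p‖ ^ 2 / 4 * confFactor c p = 1 - confFactor c p := by
    rw [confFactor]
    linear_combination mul_inv_cancel₀ hp.ne'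
  have hc3 : c ^ 3 = c := by rcases hc with rfl | rfl | rfl <;> norm_num
  have h4 : ∀ a b : ℝ × EuclideanSpace ℝ (Fin m), ambientForm m c a b
      = c * (a.1 * b.1) + ⟪a.2, b.2⟫ := fun _ _ => rfl
  rw [h4, h3, h3]
  simp only [inner_add_left, inner_add_right, real_inner_smul_left, real_inner_smul_right,
    real_inner_self_eq_norm_sq]
  rw [real_inner_comm p v]
  generalize confFactor c p = l at *
  linear_combination (c ^ 3 * l ^ 4 * ⟪p, v⟫ * ⟪p, w⟫) * hε
    + (c * l ^ 3 * ⟪p, v⟫ * ⟪p, w⟫) * hk + (l ^ 4 * ⟪p, v⟫ * ⟪p, w⟫) * hc3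

theorem incl_eq_stereoInv {ε : ℝ} (hε : ε ^ 2 = 1) {q : SpaceForm m c}
    (hq : q ∈ (stereo m c ε hε).source) : q.incl = stereoInv c ε (stereo m c ε hε q) := by
  rw [← incl_stereoInvPt hε ((stereo m c ε hε).map_source hq)]
  exact congr_arg incl ((stereo m c ε hε).left_inv hq).symm

theorem isOpen_stereoTarget (ε : ℝ) (hε : ε ^ 2 = 1) : IsOpen (stereoTarget m c ε) :=
  (stereo m c ε hε).open_target

theorem contMDiff_incl : ContMDiff 𝓘(ℝ, EuclideanSpace ℝ (Fin m))
    𝓘(ℝ, ℝ × EuclideanSpace ℝ (Fin m)) ∞ (incl : SpaceForm m c → _) := fun q => by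
  obtain ⟨ε, hε, he⟩ := chart_mem_atlas (EuclideanSpace ℝ (Fin m)) q
  have hq := mem_chart_source (EuclideanSpace ℝ (Fin m)) q
  have h1 := contMDiffAt_of_mem_maximalAtlas (n := ∞) (IsManifold.subset_maximalAtlas
    (I := 𝓘(ℝ, EuclideanSpace ℝ (Fin m))) (chart_mem_atlas (EuclideanSpace ℝ (Fin m)) q)) hq
  rw [he] at h1 hq
  have h2 := ((contDiffOn_stereoInv (m := m) (c := c) ε).contDiffAt
    ((isOpen_stereoTarget ε hε).mem_nhds ((stereo m c ε hε).map_source hq))).contMDiffAt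
  refine (h2.comp q h1).congr_of_eventuallyEq ?_
  filter_upwards [(stereo m c ε hε).open_source.mem_nhds hq] with z hz using incl_eq_stereoInv hε hz

end SpaceForm

namespace RobertsonWalker

variable {I : TopologicalSpace.Opens ℝ} {m : ℕ} {c : ℝ}

/-- Each chart of `I × R^m(c)` is the product of the inclusion of `I` in `ℝ` and a stereographic
projection. -/
theorem exists_eq_prod_stereo {e' : OpenPartialHomeomorph (RobertsonWalker I m c)
      (ModelProd ℝ (EuclideanSpace ℝ (Fin m)))}
    (he' : e' ∈ atlas (ModelProd ℝ (EuclideanSpace ℝ (Fin m))) (RobertsonWalker I m c)) :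
    ∃ (e₁ : OpenPartialHomeomorph I ℝ) (ε : ℝ) (hε : ε ^ 2 = 1),
      (∀ t, e₁ t = t) ∧ e₁.source = univ ∧ e' = e₁.prod (SpaceForm.stereo m c ε hε) := by
  obtain ⟨e₁, h1, e₂, ⟨ε, hε, rfl⟩, rfl⟩ := he'
  obtain ⟨t, ht⟩ := mem_iUnion.mp h1
  obtain rfl := mem_singleton_iff.mp ht
  exact ⟨_, ε, hε, fun t => rfl, by simp [chartAt_self_eq], rfl⟩

theorem mem_target_iff {e₁ : OpenPartialHomeomorph I ℝ} (h₁ : ∀ t, e₁ t = t)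
    (hs : e₁.source = univ) {t : ℝ} : t ∈ e₁.target ↔ t ∈ I := by
  rw [← e₁.image_source_eq_target, hs, image_univ]
  constructor
  · rintro ⟨s, rfl⟩
    rw [h₁]
    exact s.2
  · exact fun ht => ⟨⟨t, ht⟩, h₁ _⟩

theorem mfderiv_coe_opens (t : I) (v : ℝ) :
    mfderiv 𝓘(ℝ, ℝ) 𝓘(ℝ, ℝ) (fun s : I => (s : ℝ)) t v = v := by
  have hd : MDifferentiableAt 𝓘(ℝ, ℝ) 𝓘(ℝ, ℝ) (fun s : I => (s : ℝ)) t :=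
    (contMDiff_subtype_val (n := ∞) t).mdifferentiableAt (by simp)
  have h : writtenInExtChartAt 𝓘(ℝ, ℝ) 𝓘(ℝ, ℝ) t (fun s : I => (s : ℝ)) =ᶠ[𝓝 (t : ℝ)] id := by
    filter_upwards [extChartAt_target_mem_nhds (I := 𝓘(ℝ, ℝ)) t] with s hs
      using (extChartAt 𝓘(ℝ, ℝ) t).right_inv hs
  rw [hd.mfderiv, modelWithCornersSelf_coe, range_id, fderivWithin_univ]
  exact (DFunLike.congr_fun (h.fderiv_eq (𝕜 := ℝ)) v).trans (by simp)

section Chart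

variable {e' : OpenPartialHomeomorph (RobertsonWalker I m c)
  (ModelProd ℝ (EuclideanSpace ℝ (Fin m)))}

theorem isOpen_target (e' : OpenPartialHomeomorph (RobertsonWalker I m c)
    (ModelProd ℝ (EuclideanSpace ℝ (Fin m)))) :
    IsOpen (e'.target : Set (ℝ × EuclideanSpace ℝ (Fin m))) := e'.open_target

/-- The chart domains consist of pairs `(t, w)` with `t ∈ I` and `w` in the domain of the conformal
factor. -/
theorem mem_of_mem_target
    (he' : e' ∈ atlas (ModelProd ℝ (EuclideanSpace ℝ (Fin m))) (RobertsonWalker I m c))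
    {y : ℝ × EuclideanSpace ℝ (Fin m)} (hy : y ∈ e'.target) :
    y.1 ∈ I ∧ 0 < 1 + c * ‖y.2‖ ^ 2 / 4 := by
  obtain ⟨e₁, ε, hε, h₁, hs, rfl⟩ := exists_eq_prod_stereo he'
  exact ⟨(mem_target_iff h₁ hs).mp hy.1, hy.2.1⟩

/-- In a chart, the metric of the Robertson-Walker space is `-dt² + (f λ)² |dw|²`. -/
theorem metricInChart_eq (hc : c = 1 ∨ c = 0 ∨ c = -1) (f : ℝ → ℝ)
    (he' : e' ∈ atlas (ModelProd ℝ (EuclideanSpace ℝ (Fin m))) (RobertsonWalker I m c))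
    {y : ℝ × EuclideanSpace ℝ (Fin m)} (hy : y ∈ e'.target) :
    metricInChart (model m) (metric f) e' y = coordForm f c y := by
  have hA : MDifferentiableAt 𝓘(ℝ, ℝ × EuclideanSpace ℝ (Fin m)) (model m)
      (e'.extend (model m)).symm y := by
    have h := contMDiffOn_extend_symm (n := ∞)
      (IsManifold.subset_maximalAtlas (I := model m) he')
    refine (h.contMDiffAt ?_).mdifferentiableAt (by simp)
    exact ((model m).toHomeomorph.isOpenMap _ e'.open_target).mem_nhds ⟨y, hy, rfl⟩
  set p := (e'.extend (model m)).symm y with hp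
  have ht : MDifferentiableAt (model m) 𝓘(ℝ, ℝ) (fun q : RobertsonWalker I m c => (q.1 : ℝ)) p :=
    (((contMDiff_subtype_val (n := ∞)).comp contMDiff_fst) p).mdifferentiableAt (by simp)
  have hx : MDifferentiableAt (model m) 𝓘(ℝ, ℝ × EuclideanSpace ℝ (Fin m))
      (fun q : RobertsonWalker I m c => q.2.incl) p :=
    ((SpaceForm.contMDiff_incl.comp contMDiff_snd) p).mdifferentiableAt (by simp)
  have htA := mfderiv_comp (f := (e'.extend (model m)).symm) y ht hA
  have hxA := mfderiv_comp (f := (e'.extend (model m)).symm) y hx hA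
  obtain ⟨e₁, ε, hε, h₁, hs, rfl⟩ := exists_eq_prod_stereo he'
  have hE1 : ∀ z ∈ (e₁.prod (SpaceForm.stereo m c ε hε)).target,
      ((((e₁.prod (SpaceForm.stereo m c ε hε)).extend (model m)).symm z).1 : ℝ) = z.1 :=
    fun z hz => (h₁ _).symm.trans (e₁.right_inv hz.1)
  have hE2 : ∀ z ∈ (e₁.prod (SpaceForm.stereo m c ε hε)).target,
      (((e₁.prod (SpaceForm.stereo m c ε hε)).extend (model m)).symm z).2.incl
        = SpaceForm.stereoInv c ε z.2 := fun z hz => SpaceForm.incl_stereoInvPt hε hz.2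
  have hnhds := (isOpen_target (e₁.prod (SpaceForm.stereo m c ε hε))).mem_nhds hy
  have hpos := (mem_of_mem_target he' hy).2
  have htd : ∀ v, dt p (mfderiv 𝓘(ℝ, ℝ × EuclideanSpace ℝ (Fin m)) (model m)
      ((e₁.prod (SpaceForm.stereo m c ε hε)).extend (model m)).symm y v) = v.1 := fun v => by
    have h2 : (fun q : RobertsonWalker I m c => (q.1 : ℝ)) ∘
        ((e₁.prod (SpaceForm.stereo m c ε hε)).extend (model m)).symm =ᶠ[𝓝 y] Prod.fst := by
      filter_upwards [hnhds] with z hz using hE1 z hz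
    rw [h2.mfderiv_eq, mfderiv_eq_fderiv, fderiv_fst] at htA
    exact (DFunLike.congr_fun htA v).symm
  have hxd : ∀ v, dx p (mfderiv 𝓘(ℝ, ℝ × EuclideanSpace ℝ (Fin m)) (model m)
      ((e₁.prod (SpaceForm.stereo m c ε hε)).extend (model m)).symm y v)
      = fderiv ℝ (SpaceForm.stereoInv c ε) y.2 v.2 := fun v => by
    have h2 : (fun q : RobertsonWalker I m c => q.2.incl) ∘
        ((e₁.prod (SpaceForm.stereo m c ε hε)).extend (model m)).symm
        =ᶠ[𝓝 y] SpaceForm.stereoInv c ε ∘ Prod.snd := by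
      filter_upwards [hnhds] with z hz using hE2 z hz
    have hd : DifferentiableAt ℝ (SpaceForm.stereoInv c ε) y.2 :=
      ((SpaceForm.contDiffOn_stereoInv ε).contDiffAt
        ((SpaceForm.isOpen_stereoTarget ε hε).mem_nhds hy.2)).differentiableAt (by simp)
    rw [h2.mfderiv_eq, mfderiv_eq_fderiv, fderiv_comp y hd differentiableAt_snd, fderiv_snd] at hxA
    exact (DFunLike.congr_fun hxA v).symm
  refine ContinuousLinearMap.ext fun v => ContinuousLinearMap.ext fun w => ?_
  rw [coordForm_apply, mul_pow, mul_assoc, ← SpaceForm.ambientForm_fderiv_stereoInv hc hε hpos,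
    ← htd v, ← htd w, ← hxd v, ← hxd w, ← hE1 y hy]
  rfl

/-- In a chart, the comoving observer field is the first coordinate field. -/
theorem fieldInChart_comoving
    (he' : e' ∈ atlas (ModelProd ℝ (EuclideanSpace ℝ (Fin m))) (RobertsonWalker I m c))
    {y : ℝ × EuclideanSpace ℝ (Fin m)} (hy : y ∈ e'.target) :
    fieldInChart (model m) comoving e' y = (1, 0) := by
  obtain ⟨e₁, ε, hε, h₁, hs, rfl⟩ := exists_eq_prod_stereo he'
  have hcoe : ((e₁.prod (SpaceForm.stereo m c ε hε)).extend (model m) : RobertsonWalker I m c → _)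
      = Prod.map (fun t : I => (t : ℝ)) (SpaceForm.stereo m c ε hε) :=
    funext fun q => Prod.ext (h₁ q.1) rfl
  set p := ((e₁.prod (SpaceForm.stereo m c ε hε)).extend (model m)).symm y
  have h2 : p.2 ∈ (SpaceForm.stereo m c ε hε).source :=
    (SpaceForm.stereo m c ε hε).map_target hy.2
  have hd1 : MDifferentiableAt 𝓘(ℝ, ℝ) 𝓘(ℝ, ℝ) (fun t : I => (t : ℝ)) p.1 :=
    (contMDiff_subtype_val (n := ∞) p.1).mdifferentiableAt (by simp)
  have hd2 : MDifferentiableAt 𝓘(ℝ, EuclideanSpace ℝ (Fin m)) 𝓘(ℝ, EuclideanSpace ℝ (Fin m))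
      (SpaceForm.stereo m c ε hε) p.2 :=
    (contMDiffAt_of_mem_maximalAtlas (n := ∞) (IsManifold.subset_maximalAtlas
      (I := 𝓘(ℝ, EuclideanSpace ℝ (Fin m))) (show SpaceForm.stereo m c ε hε ∈
        atlas (EuclideanSpace ℝ (Fin m)) (SpaceForm m c) from ⟨ε, hε, rfl⟩)) h2).mdifferentiableAt
          (by simp)
  have h3 := mfderiv_prodMap hd1 hd2
  change mfderiv (model m) 𝓘(ℝ, ℝ × EuclideanSpace ℝ (Fin m))
    ((e₁.prod (SpaceForm.stereo m c ε hε)).extend (model m)) p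
      ((1, 0) : ℝ × EuclideanSpace ℝ (Fin m)) = _
  rw [hcoe, modelWithCornersSelf_prod, ← chartedSpaceSelf_prod]
  refine (DFunLike.congr_fun h3 ((1, 0) : ℝ × EuclideanSpace ℝ (Fin m))).trans ?_
  exact Prod.ext (mfderiv_coe_opens p.1 1)
    (mfderiv 𝓘(ℝ, EuclideanSpace ℝ (Fin m)) 𝓘(ℝ, EuclideanSpace ℝ (Fin m))
      (SpaceForm.stereo m c ε hε) p.2).map_zero

/-- The coordinate expression of the metric in a chart is a Robertson-Walker metric. -/
theorem isCoordMetric (hc : c = 1 ∨ c = 0 ∨ c = -1) {f : ℝ → ℝ} (hf : ContDiffOn ℝ ∞ f I)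
    (hf0 : ∀ t ∈ I, f t ≠ 0)
    (he' : e' ∈ atlas (ModelProd ℝ (EuclideanSpace ℝ (Fin m))) (RobertsonWalker I m c)) :
    IsCoordMetric f c (metricInChart (model m) (metric f) e') I e'.target where
  isOpen_interval := I.isOpen
  contDiffOn := hf
  ne_zero := hf0
  isOpen := isOpen_target e'
  fst_mem _ hy := (mem_of_mem_target he' hy).1
  pos _ hy := (mem_of_mem_target he' hy).2
  eqOn _ hy := metricInChart_eq hc f he' hy

end Chart

end RobertsonWalker

open RobertsonWalker in
/-- A space-like map to a Robertson-Walker space, read in charts, is an immersion with nondegenerate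
induced metric. -/
theorem IsSpacelike.isImmersionOn {I : TopologicalSpace.Opens ℝ} {n m : ℕ} {c : ℝ}
    (hc : c = 1 ∨ c = 0 ∨ c = -1) {f : ℝ → ℝ} (hf : ContDiffOn ℝ ∞ f I) (hf0 : ∀ t ∈ I, f t ≠ 0)
    {M : Type*} [TopologicalSpace M] [ChartedSpace (EuclideanSpace ℝ (Fin m)) M]
    [IsManifold 𝓘(ℝ, EuclideanSpace ℝ (Fin m)) ∞ M] {φ : M → RobertsonWalker I n c}
    (hs : IsSpacelike m (model n) (metric f) φ)
    (hφ : ContMDiff 𝓘(ℝ, EuclideanSpace ℝ (Fin m)) (model n) ∞ φ)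
    {e : OpenPartialHomeomorph M (EuclideanSpace ℝ (Fin m))}
    (he : e ∈ atlas (EuclideanSpace ℝ (Fin m)) M)
    {e' : OpenPartialHomeomorph (RobertsonWalker I n c) (ModelProd ℝ (EuclideanSpace ℝ (Fin n)))}
    (he' : e' ∈ atlas (ModelProd ℝ (EuclideanSpace ℝ (Fin n))) (RobertsonWalker I n c)) :
    LocalGeom.IsImmersionOn (metricInChart (model n) (metric f) e') e'.target
      (mapInChart (model n) φ e e') (chartDomain φ e e') where
  isMetricOn := (isCoordMetric hc hf hf0 he').isMetricOn
  isOpen := isOpen_chartDomain hφ.continuous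
  contDiffOn := contDiffOn_mapInChart hφ he he'
  mapsTo _ hx := e'.map_source hx.2
  invertible x hx := LocalGeom.isInvertible_of_injective _ <| by
    refine (injective_iff_map_eq_zero _).mpr fun v hv => ?_
    by_contra hv0
    refine (hs.pos hφ he he' hx hv0).ne' ?_
    rw [← LocalGeom.inducedMetric_apply, hv, zero_apply]

end

theorem mainTheorem10
    (n : ℕ) (hn : 4 ≤ n) (c : ℝ) (hc : c = 1 ∨ c = 0 ∨ c = -1)
    (I : TopologicalSpace.Opens ℝ) (hI : (I : Set ℝ).OrdConnected)
    (f : ℝ → ℝ) (hf : ContDiffOn ℝ ∞ f I) (hf0 : ∀ t ∈ I, f t ≠ 0)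
    (hcurv : ∀ t ∈ I, deriv (deriv f) t / f t - (deriv f t ^ 2 + c) / f t ^ 2 ≠ 0)
    {M : Type*} [TopologicalSpace M] [ChartedSpace (EuclideanSpace ℝ (Fin 2)) M]
    [IsManifold 𝓘(ℝ, EuclideanSpace ℝ (Fin 2)) ∞ M] [ConnectedSpace M]
    (φ : M → RobertsonWalker I (n - 1) c)
    (hφ : ContMDiff 𝓘(ℝ, EuclideanSpace ℝ (Fin 2)) (RobertsonWalker.model (n - 1)) ∞ φ)
    (hspace : IsSpacelike 2 (RobertsonWalker.model (n - 1)) (RobertsonWalker.metric f) φ)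
    (hT : RobertsonWalker.TNonvanishing 2 f φ)
    (hpmcv : IsPMCV 2 (RobertsonWalker.model (n - 1)) (RobertsonWalker.metric f) φ)
    (hbic : IsBiconservative 2 (RobertsonWalker.model (n - 1)) (RobertsonWalker.metric f) φ) :
    RobertsonWalker.MeanCurvOrthogonalEta 2 f φ ∧
      RobertsonWalker.MeanCurvSpacelike 2 f φ ∧
      ¬ IsMarginallyTrapped 2 (RobertsonWalker.model (n - 1)) (RobertsonWalker.metric f) φ := by
  -- the first coordinate of `H` is `-⟨H, ∂/∂t⟩`
  have hMC : HoldsInCharts 2 (RobertsonWalker.model (n - 1)) (RobertsonWalker.metric f) φ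
      fun _ G u x => (LocalGeom.meanCurv G u x).1 = 0 := by
    intro e he e' he' x hx
    have hG := RobertsonWalker.isCoordMetric hc hf hf0 he'
    have hu := hspace.isImmersionOn hc hf hf0 hφ he he'
    have hT' := hT e he e' he' x hx
    beta_reduce at hT'
    rw [RobertsonWalker.fieldInChart_comoving he' (hu.mapsTo hx)] at hT'
    exact hG.meanCurv_fst_eq_zero hu le_rfl (hpmcv e he e' he') hx
      (hcurv _ (hG.fst_mem _ (hu.mapsTo hx))) (fun v hv => hspace.pos hφ he he' hx hv) hT'
      (hbic e he e' he' x hx)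
  have hsl : RobertsonWalker.MeanCurvSpacelike 2 f φ := fun e he e' he' x hx =>
    (RobertsonWalker.isCoordMetric hc hf hf0 he').pos_or_eq_zero
      ((hspace.isImmersionOn hc hf hf0 hφ he he').mapsTo hx) (hMC e he e' he' x hx)
  refine ⟨fun e he e' he' x hx => ?_, hsl, fun hmt => ?_⟩
  · have hu := hspace.isImmersionOn hc hf hf0 hφ he he'
    beta_reduce
    rw [RobertsonWalker.fieldInChart_comoving he' (hu.mapsTo hx)]
    exact (RobertsonWalker.isCoordMetric hc hf hf0 he').metric_meanCurv_normalPart hu two_ne_zero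
      hx (hMC e he e' he' x hx)
  · obtain ⟨p⟩ := (inferInstance : Nonempty M)
    have he := chart_mem_atlas (EuclideanSpace ℝ (Fin 2)) p
    have he' := chart_mem_atlas (ModelProd ℝ (EuclideanSpace ℝ (Fin (n - 1)))) (φ p)
    have hp := mem_chart_source (EuclideanSpace ℝ (Fin 2)) p
    have hx : chartAt (EuclideanSpace ℝ (Fin 2)) p p ∈ chartDomain φ
        (chartAt (EuclideanSpace ℝ (Fin 2)) p)
        (chartAt (ModelProd ℝ (EuclideanSpace ℝ (Fin (n - 1)))) (φ p)) := by
      refine ⟨(chartAt _ p).map_source hp, ?_⟩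
      rw [(chartAt (EuclideanSpace ℝ (Fin 2)) p).left_inv hp]
      exact mem_chart_source _ (φ p)
    obtain ⟨h0, hne⟩ := hmt _ he _ he' _ hx
    exact (hsl _ he _ he' _ hx).elim (fun h => h.ne' h0) hne
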